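/- **Conventions.** Let $A$ be a commutative (complex, not necessarily unital) Banach algebra. A Banach $A$-bimodule $X$ is a Banach space with commuting left and right actions of $A$ by bounded bilinear maps; it is symmetric if $ax=xa$ for all $a\in A$, $x\in X$. For $n\ge 0$ put $C_n(A,X)=X\widehat\otimes A^{\widehat\otimes n}$ (projective tensor products), let $C^n(A,X)$ be the space of bounded $n$-linear maps $A^n\to X$, and let $$d_n(x\otimes a_1\otimes\cdots\otimes a_{n+1})=xa_1\otimes a_2\otimes\cdots\otimes a_{n+1}+\sum_{j=1}^n(-1)^j x\otimes a_1\otimes\cdots\otimes a_ja_{j+1}\otimes\cdots\otimes a_{n+1}+(-1)^{n+1}a_{n+1}x\otimes a_1\otimes\cdots\otimes a_n,$$ $$(\delta^n\psi)(a_1,\dots,a_{n+1})=a_1\psi(a_2,\dots,a_{n+1})+\sum_{j=1}^n(-1)^j\psi(a_1,\dots,a_ja_{j+1},\dots,a_{n+1})+(-1)^{n+1}\psi(a_1,\dots,a_n)a_{n+1}$$ be the Hochschild boundary $C_{n+1}\to C_n$ and coboundary $C^n\to C^{n+1}$. The symmetric group $S_n$ acts on $A^{\widehat\otimes n}$ by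 moving the $k$-th factor to the place $\sigma(k)$. Let $s_n=\sum_{0<p<n}\sum_\sigma \mathrm{sgn}(\sigma)\,\sigma$, where $\sigma$ runs through the $(p,n-p)$-shuffles (the $\sigma\in S_n$ increasing on $\{1,\dots,p\}$ and on $\{p+1,\dots,n\}$), and let $$e_n^{(1)}=\prod_{j=2}^n\Bigl(1-\frac{s_n}{2^j-2}\Bigr)\in\mathbb Q S_n$$ be the first Barr–Gerstenhaber–Schack idempotent. The Harrison chains $C_n^{\mathrm{Harr}}(A,X)$ are the range of $\mathrm{id}\widehat\otimes e_n^{(1)}$ on $C_n(A,X)$, and the Harrison cochains $C^n_{\mathrm{Harr}}(A,X)$ are the range of precomposition with $e_n^{(1)}$ on $C^n(A,X)$. **Lemma 4.1.** Let $A$ be a commutative Banach algebra, and let $L\xrightarrow{\iota}M\xrightarrow{q}N$ be a short exact sequence of symmetric Banach $A$-bimodules and bounded bimodule maps that splits in $\mathsf{Ban}$, i.e. there are bounded linear maps $r:M\to L$ and $s:N\to M$ with $r\iota=\mathrm{id}$, $qs=\mathrm{id}$ and $\iota r+sq=\mathrm{id}$. For $X=L,M,N$ the Harrison chains and cochains form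 subcomplexes of the Hochschild complexes; let $H_n^{\mathrm{Harr}}(A,X)$ and $H^n_{\mathrm{Harr}}(A,X)$ be their homology and cohomology, with the quotient seminorms. Then there are long exact sequences $$0\leftarrow H_1^{\mathrm{Harr}}(A,N)\leftarrow H_1^{\mathrm{Harr}}(A,M)\leftarrow H_1^{\mathrm{Harr}}(A,L)\leftarrow H_2^{\mathrm{Harr}}(A,N)\leftarrow H_2^{\mathrm{Harr}}(A,M)\leftarrow\cdots$$ and $$0\to H^1_{\mathrm{Harr}}(A,L)\to H^1_{\mathrm{Harr}}(A,M)\to H^1_{\mathrm{Harr}}(A,N)\to H^2_{\mathrm{Harr}}(A,L)\to H^2_{\mathrm{Harr}}(A,M)\to\cdots$$ in which the maps between groups of the same degree are induced by $\iota$ and $q$, and the others are bounded linear connecting maps, given by the usual rule: the class of a cycle $z$ is sent to the class of $l$ whenever $m$ is a Harrison chain with $q_*m=z$ and $l$ is a Harrison cycle with $\iota_*l=dm$ (and likewise, with $\delta$, for cochains). -/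

import Mathlib

open scoped TensorProduct

noncomputable section

namespace HarrisonBanach

/-! ## The projective tensor product of two (semi)normed spaces -/

/-- The algebraic tensor product `E ⊗ F` over `ℂ`, to be given the projective seminorm. -/
def ProjTensor (E F : Type*) [SeminormedAddCommGroup E] [NormedSpace ℂ E]
    [SeminormedAddCommGroup F] [NormedSpace ℂ F] : Type _ := E ⊗[ℂ] F

namespace ProjTensor

section

set_option linter.unusedSectionVars false

variable {E F : Type*} [SeminormedAddCommGroup E] [NormedSpace ℂ E]
  [SeminormedAddCommGroup F] [NormedSpace ℂ F]

instance : AddCommGroup (ProjTensor E F) := inferInstanceAs (AddCommGroup (E ⊗[ℂ] F))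

instance : Module ℂ (ProjTensor E F) := inferInstanceAs (Module ℂ (E ⊗[ℂ] F))

/-- The elementary tensor `x ⊗ y`. -/
def tmul (x : E) (y : F) : ProjTensor E F := x ⊗ₜ[ℂ] y

/-- The finite families `(x_j, y_j)` with `∑ x_j ⊗ y_j = t`. -/
def Reps (t : ProjTensor E F) : Type _ :=
  {l : List (E × F) // (l.map fun p => tmul p.1 p.2).sum = t}

/-- The cost `∑ ‖x_j‖ ‖y_j‖` of a representation. -/
def cost (l : List (E × F)) : ℝ := (l.map fun p => ‖p.1‖ * ‖p.2‖).sum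

lemma cost_nonneg (l : List (E × F)) : 0 ≤ cost l := by
  refine List.sum_nonneg fun a ha => ?_
  obtain ⟨p, -, rfl⟩ := List.mem_map.1 ha
  positivity

/-- The projective seminorm: the infimum of `∑ ‖x_j‖ ‖y_j‖` over all representations
`t = ∑ x_j ⊗ y_j`. -/
def projNorm (t : ProjTensor E F) : ℝ := ⨅ l : Reps t, cost l.1

lemma bddBelow_cost (t : ProjTensor E F) :
    BddBelow (Set.range fun l : Reps t => cost l.1) :=
  ⟨0, by rintro _ ⟨l, rfl⟩; exact cost_nonneg _⟩

instance (t : ProjTensor E F) : Nonempty (Reps t) := by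
  change Nonempty {l : List (E × F) // (l.map fun p => tmul p.1 p.2).sum = t}
  induction t using TensorProduct.induction_on with
  | zero => exact ⟨⟨[], rfl⟩⟩
  | tmul x y => exact ⟨⟨[(x, y)], add_zero (x ⊗ₜ[ℂ] y)⟩⟩
  | add a b ha hb =>
    obtain ⟨⟨l, hl⟩⟩ := ha
    obtain ⟨⟨m, hm⟩⟩ := hb
    exact ⟨⟨l ++ m, by rw [List.map_append, List.sum_append, hl, hm]; rfl⟩⟩

lemma projNorm_le {t : ProjTensor E F} (l : List (E × F))
    (hl : (l.map fun p => tmul p.1 p.2).sum = t) : projNorm t ≤ cost l :=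
  ciInf_le (bddBelow_cost t) (⟨l, hl⟩ : Reps t)

lemma projNorm_zero : projNorm (0 : ProjTensor E F) = 0 :=
  le_antisymm (projNorm_le [] rfl) (le_ciInf fun _ => cost_nonneg _)

lemma projNorm_add_le (s t : ProjTensor E F) : projNorm (s + t) ≤ projNorm s + projNorm t := by
  refine le_ciInf_add_ciInf fun l m => (projNorm_le (l.1 ++ m.1) ?_).trans_eq ?_
  · rw [List.map_append, List.sum_append, l.2, m.2]
  · simp [cost]

lemma projNorm_smul_le (c : ℂ) (t : ProjTensor E F) : projNorm (c • t) ≤ ‖c‖ * projNorm t := by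
  unfold projNorm
  rw [Real.mul_iInf_of_nonneg (norm_nonneg c)]
  refine le_ciInf fun l => (projNorm_le (l.1.map fun p => (c • p.1, p.2)) ?_).trans_eq ?_
  · have h : ∀ m : List (E × F),
        ((m.map fun p => (c • p.1, p.2)).map fun p => tmul p.1 p.2).sum
          = c • (m.map fun p => tmul p.1 p.2).sum := by
      intro m
      induction m with
      | nil => simp
      | cons a m ih =>
        simp only [List.map_cons, List.sum_cons, smul_add, ← ih]
        rfl
    rw [h, l.2]
  · simp [cost, Function.comp_def, norm_smul, mul_assoc, List.sum_map_mul_left]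

/-- The projective seminorm as a `Seminorm`. -/
def projSeminorm : Seminorm ℂ (ProjTensor E F) :=
  .ofSMulLE projNorm projNorm_zero projNorm_add_le projNorm_smul_le

instance : SeminormedAddCommGroup (ProjTensor E F) :=
  AddGroupSeminorm.toSeminormedAddCommGroup projSeminorm.toAddGroupSeminorm

instance : NormedSpace ℂ (ProjTensor E F) := ⟨projNorm_smul_le⟩

lemma norm_tmul_le (x : E) (y : F) : ‖tmul x y‖ ≤ ‖x‖ * ‖y‖ :=
  (projNorm_le [(x, y)] (by simp)).trans_eq (by simp [cost])

lemma norm_map_le {G : Type*} [SeminormedAddCommGroup G] [NormedSpace ℂ G]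
    (f : ProjTensor E F →ₗ[ℂ] G) (C : ℝ) (hC : 0 ≤ C)
    (h : ∀ x y, ‖f (tmul x y)‖ ≤ C * (‖x‖ * ‖y‖)) (t : ProjTensor E F) :
    ‖f t‖ ≤ C * ‖t‖ := by
  change ‖f t‖ ≤ C * (⨅ l : Reps t, cost l.1)
  rw [Real.mul_iInf_of_nonneg hC]
  refine le_ciInf fun l => ?_
  obtain ⟨l, rfl⟩ := l
  dsimp only
  induction l with
  | nil => simp [cost]
  | cons a l ih =>
    simp only [List.map_cons, List.sum_cons, map_add, cost, mul_add] at ih ⊢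
    exact (norm_add_le _ _).trans (add_le_add (h _ _) ih)

variable (E F) in
/-- The canonical bounded bilinear map `(x, y) ↦ x ⊗ y`. -/
def mk : E →L[ℂ] F →L[ℂ] ProjTensor E F :=
  LinearMap.mkContinuous₂ (TensorProduct.mk ℂ E F : E →ₗ[ℂ] F →ₗ[ℂ] ProjTensor E F) 1
    fun x y => by rw [one_mul]; exact norm_tmul_le x y

@[simp] lemma mk_apply (x : E) (y : F) : mk E F x y = tmul x y := rfl

/-- The universal property: a bounded bilinear map extends to a bounded linear map. -/
def lift {G : Type*} [SeminormedAddCommGroup G] [NormedSpace ℂ G]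
    (B : E →L[ℂ] F →L[ℂ] G) : ProjTensor E F →L[ℂ] G :=
  LinearMap.mkContinuous
    (TensorProduct.lift ((ContinuousLinearMap.coeLM ℂ).comp B.toLinearMap) :
      E ⊗[ℂ] F →ₗ[ℂ] G) ‖B‖
    (norm_map_le _ _ (norm_nonneg B) fun x y =>
      (B.le_opNorm₂ x y).trans_eq (mul_assoc _ _ _))

@[simp] lemma lift_tmul {G : Type*} [SeminormedAddCommGroup G] [NormedSpace ℂ G]
    (B : E →L[ℂ] F →L[ℂ] G) (x : E) (y : F) : lift B (tmul x y) = B x y :=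
  TensorProduct.lift.tmul x y

lemma ext {G : Type*} [SeminormedAddCommGroup G] [NormedSpace ℂ G]
    {f g : ProjTensor E F →L[ℂ] G} (h : ∀ x y, f (tmul x y) = g (tmul x y)) : f = g := by
  have h' : (f.toLinearMap : E ⊗[ℂ] F →ₗ[ℂ] G) = g.toLinearMap := TensorProduct.ext' h
  exact ContinuousLinearMap.coe_injective h'

end

section

variable {E F E' F' : Type*} [SeminormedAddCommGroup E] [NormedSpace ℂ E]
  [SeminormedAddCommGroup F] [NormedSpace ℂ F] [SeminormedAddCommGroup E'] [NormedSpace ℂ E']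
  [SeminormedAddCommGroup F'] [NormedSpace ℂ F']

/-- The tensor product `f ⊗ g` of bounded linear maps. -/
def map (f : E →L[ℂ] E') (g : F →L[ℂ] F') : ProjTensor E F →L[ℂ] ProjTensor E' F' :=
  lift ((ContinuousLinearMap.compL ℂ F F' _).flip g ∘L mk E' F' ∘L f)

@[simp] lemma map_tmul (f : E →L[ℂ] E') (g : F →L[ℂ] F') (x : E) (y : F) :
    map f g (tmul x y) = tmul (f x) (g y) := by
  simp [map]

end

end ProjTensor


open ContinuousLinearMap UniformSpace

/-! ## Banach bimodules -/

section Bimodules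

variable (A : Type*) [NonUnitalNormedCommRing A] [NormedSpace ℂ A]

/-- A two-sided action of `A` on the normed space `M` through bounded bilinear maps (not
necessarily contractive, and without any unit condition): `lact a m = a · m`, `ract a m = m · a`.
For complete `A` and `M` this is a Banach `A`-bimodule. -/
class BanachBimodule (M : Type*) [NormedAddCommGroup M] [NormedSpace ℂ M] where
  lact : A →L[ℂ] M →L[ℂ] M
  ract : A →L[ℂ] M →L[ℂ] M
  lact_mul : ∀ (a b : A) (m : M), lact (a * b) m = lact a (lact b m)
  ract_mul : ∀ (a b : A) (m : M), ract (a * b) m = ract b (ract a m)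
  lact_ract : ∀ (a b : A) (m : M), ract b (lact a m) = lact a (ract b m)

/-- `M` is symmetric: `a · m = m · a`. -/
def IsSymmetricBimodule (M : Type*) [NormedAddCommGroup M] [NormedSpace ℂ M]
    [BanachBimodule A M] : Prop :=
  ∀ (a : A) (m : M), BanachBimodule.lact a m = BanachBimodule.ract a m

/-- Bounded `A`-bimodule maps. -/
structure BimoduleHom (M N : Type*) [NormedAddCommGroup M] [NormedSpace ℂ M] [BanachBimodule A M]
    [NormedAddCommGroup N] [NormedSpace ℂ N] [BanachBimodule A N] extends M →L[ℂ] N where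
  map_lact : ∀ (a : A) (m : M),
    toContinuousLinearMap (BanachBimodule.lact a m)
      = BanachBimodule.lact a (toContinuousLinearMap m)
  map_ract : ∀ (a : A) (m : M),
    toContinuousLinearMap (BanachBimodule.ract a m)
      = BanachBimodule.ract a (toContinuousLinearMap m)

end Bimodules

/-- The sequence `L → M → N` of bounded maps is short exact and splits in the category of Banach
spaces and bounded linear maps. -/
structure IsSplitShortExact {L M N : Type*} [NormedAddCommGroup L] [NormedSpace ℂ L]
    [NormedAddCommGroup M] [NormedSpace ℂ M] [NormedAddCommGroup N] [NormedSpace ℂ N]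
    (i : L →L[ℂ] M) (q : M →L[ℂ] N) : Prop where
  injective : Function.Injective i
  exact : Function.Exact i q
  surjective : Function.Surjective q
  split : ∃ (r : M →L[ℂ] L) (s : N →L[ℂ] M),
    r ∘L i = .id ℂ L ∧ q ∘L s = .id ℂ N ∧ i ∘L r + s ∘L q = .id ℂ M

/-! ## Idempotents in the group algebra of the symmetric group -/

/-- `σ` is a `(p, n - p)`-shuffle: it is increasing on the first `p` places and on the remaining
ones. -/
def IsShuffle {n : ℕ} (p : ℕ) (σ : Equiv.Perm (Fin n)) : Prop :=
  (∀ k l : Fin n, k < l → (l : ℕ) < p → σ k < σ l) ∧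
    (∀ k l : Fin n, k < l → p ≤ (k : ℕ) → σ k < σ l)

open Classical in
/-- The signed sum `s_n = ∑_{0 < p < n} ∑_σ sgn(σ) σ`, with `σ` running through the
`(p, n - p)`-shuffles. -/
def shuffleElement (n : ℕ) : MonoidAlgebra ℂ (Equiv.Perm (Fin n)) :=
  ∑ p ∈ Finset.Ioo 0 n, ∑ σ : Equiv.Perm (Fin n) with IsShuffle p σ,
    MonoidAlgebra.single σ ((Equiv.Perm.sign σ : ℤ) : ℂ)

/-- The Barr-Gerstenhaber-Schack (Eulerian) idempotent `e_n^{(i)}`: the spectral projection of `s_n`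
for the eigenvalue `2^i - 2`, that is
`e_n^{(i)} = ∏_{1 ≤ j ≤ n, j ≠ i} (s_n - (2^j - 2)) / ((2^i - 2) - (2^j - 2))`.
Its coefficients are rational. -/
def bgs (n i : ℕ) : MonoidAlgebra ℂ (Equiv.Perm (Fin n)) :=
  Polynomial.aeval (shuffleElement n)
    (Lagrange.basis (Finset.Icc 1 n) (fun j : ℕ => (2 : ℂ) ^ j - 2) i)

section Tensors

variable (A : Type*) [NonUnitalNormedCommRing A] [NormedSpace ℂ A]

/-- The `n`-fold tensor power of `A` with its projective seminorm, before completion. -/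
abbrev TPow (n : ℕ) : Type _ := ⨂[ℂ] _ : Fin n, A

variable {A}

/-- The elementary tensor `a_1 ⊗ ⋯ ⊗ a_n`. -/
abbrev tpure {n : ℕ} (a : Fin n → A) : TPow A n := PiTensorProduct.tprod ℂ a

lemma tpow_ext {n : ℕ} {G : Type*} [SeminormedAddCommGroup G] [NormedSpace ℂ G]
    {f g : TPow A n →L[ℂ] G} (h : ∀ a : Fin n → A, f (tpure a) = g (tpure a)) : f = g :=
  ContinuousLinearMap.coe_injective (PiTensorProduct.ext (MultilinearMap.ext h))

variable (A) in
/-- The left action of the symmetric group on the tensor power by permuting the factors: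
`σ (a_1 ⊗ ⋯ ⊗ a_n)` has `a_k` at the place `σ k`. -/
def permAction (n : ℕ) : Equiv.Perm (Fin n) →* (TPow A n →L[ℂ] TPow A n) where
  toFun σ := PiTensorProduct.liftIsometry ℂ (fun _ : Fin n => A) (TPow A n)
    ((PiTensorProduct.tprodL ℂ (E := fun _ : Fin n => A)).domDomCongr σ⁻¹)
  map_one' := tpow_ext fun a => by simp
  map_mul' σ τ := tpow_ext fun a => by simp

lemma permAction_pure {n : ℕ} (σ : Equiv.Perm (Fin n)) (a : Fin n → A) :
    permAction A n σ (tpure a) = tpure (a ∘ ⇑σ⁻¹) := by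
  simp [permAction, Function.comp_def]

variable (A) in
/-- The induced action of the group algebra. -/
def algAction (n : ℕ) :
    MonoidAlgebra ℂ (Equiv.Perm (Fin n)) →ₐ[ℂ] (TPow A n →L[ℂ] TPow A n) :=
  MonoidAlgebra.lift ℂ _ _ (permAction A n)

lemma contractNth_update [IsScalarTower ℂ A A] [SMulCommClass ℂ A A] {n : ℕ} (j : Fin n)
    (a : Fin (n + 1) → A) (k : Fin (n + 1)) :
    ∃ (l : Fin n) (φ : A →ₗ[ℂ] A), ∀ x : A,
      Fin.contractNth j.castSucc (· * ·) (Function.update a k x)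
        = Function.update (Fin.contractNth j.castSucc (· * ·) a) l (φ x) := by
  rcases lt_trichotomy (k : ℕ) j with h | h | h
  · refine ⟨⟨k, by omega⟩, LinearMap.id, fun x => funext fun m => ?_⟩
    simp only [Fin.contractNth, Function.update_apply, Fin.ext_iff, Fin.val_castSucc, Fin.val_succ,
      LinearMap.id_apply]
    grind
  · refine ⟨j, LinearMap.mulRight ℂ (a j.succ), fun x => funext fun m => ?_⟩
    simp only [Fin.contractNth, Function.update_apply, Fin.ext_iff, Fin.val_castSucc, Fin.val_succ,
      LinearMap.mulRight_apply]
    grind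
  · rcases Nat.lt_or_ge (j + 1 : ℕ) k with h' | h'
    · refine ⟨⟨k - 1, by omega⟩, LinearMap.id, fun x => funext fun m => ?_⟩
      simp only [Fin.contractNth, Function.update_apply, Fin.ext_iff, Fin.val_castSucc,
        Fin.val_succ, LinearMap.id_apply]
      grind
    · refine ⟨j, LinearMap.mulLeft ℂ (a j.castSucc), fun x => funext fun m => ?_⟩
      simp only [Fin.contractNth, Function.update_apply, Fin.ext_iff, Fin.val_castSucc,
        Fin.val_succ, LinearMap.mulLeft_apply]
      grind

section

variable [IsScalarTower ℂ A A] [SMulCommClass ℂ A A]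

variable (A) in
/-- The multilinear map `(a_1, …, a_{n+1}) ↦ a_1 ⊗ ⋯ ⊗ a_j a_{j+1} ⊗ ⋯ ⊗ a_{n+1}`
(with `j` counted from `0`). -/
def mergeMultilinear {n : ℕ} (j : Fin n) :
    ContinuousMultilinearMap ℂ (fun _ : Fin (n + 1) => A) (TPow A n) where
  toFun a := tpure (Fin.contractNth j.castSucc (· * ·) a)
  map_update_add' {_} a k x y := by
    obtain ⟨l, φ, h⟩ := contractNth_update j a k
    convert MultilinearMap.map_update_add (PiTensorProduct.tprod ℂ)
      (Fin.contractNth j.castSucc (· * ·) a) l (φ x) (φ y)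
    · rw [← map_add, ← h]; congr!
    · rw [← h]; congr!
    · rw [← h]; congr!
  map_update_smul' {_} a k c x := by
    obtain ⟨l, φ, h⟩ := contractNth_update j a k
    convert MultilinearMap.map_update_smul (PiTensorProduct.tprod ℂ)
      (Fin.contractNth j.castSucc (· * ·) a) l c (φ x)
    · rw [← map_smul, ← h]; congr!
    · rw [← h]; congr!
  cont := by
    refine (PiTensorProduct.tprodL ℂ (E := fun _ : Fin n => A)).cont.comp
      (continuous_pi fun k => ?_)
    unfold Fin.contractNth
    split_ifs <;> fun_prop

variable (A) in
/-- The bounded map `a_1 ⊗ ⋯ ⊗ a_{n+1} ↦ a_1 ⊗ ⋯ ⊗ a_j a_{j+1} ⊗ ⋯ ⊗ a_{n+1}`. -/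
def merge {n : ℕ} (j : Fin n) : TPow A (n + 1) →L[ℂ] TPow A n :=
  PiTensorProduct.liftIsometry ℂ (fun _ : Fin (n + 1) => A) (TPow A n) (mergeMultilinear A j)

lemma merge_pure {n : ℕ} (j : Fin n) (a : Fin (n + 1) → A) :
    merge A j (tpure a) = tpure (Fin.contractNth j.castSucc (· * ·) a) := by
  simp [merge, mergeMultilinear]

end

end Tensors

/-! ## Hochschild chains -/

section Chains

variable (A : Type*) [NonUnitalNormedCommRing A] [NormedSpace ℂ A]
  (M : Type*) [NormedAddCommGroup M] [NormedSpace ℂ M]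

/-- `M ⊗ A^{⊗ n}` with its projective seminorm, before completion. -/
abbrev PreChain (n : ℕ) : Type _ := ProjTensor M (TPow A n)

/-- The Hochschild chains: the completed projective tensor product of `M` and `n` copies
of `A`. -/
abbrev Chain (n : ℕ) : Type _ := Completion (PreChain A M n)

variable {A M}

lemma preChain_ext {n : ℕ} {G : Type*} [SeminormedAddCommGroup G] [NormedSpace ℂ G]
    {f g : PreChain A M n →L[ℂ] G}
    (h : ∀ (x : M) (a : Fin n → A),
      f (ProjTensor.tmul x (tpure a)) = g (ProjTensor.tmul x (tpure a))) : f = g := by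
  refine ProjTensor.ext fun x t => ?_
  have : f ∘L ProjTensor.mk M (TPow A n) x = g ∘L ProjTensor.mk M (TPow A n) x :=
    tpow_ext fun a => h x a
  exact congrArg (fun u : TPow A n →L[ℂ] G => u t) this

/-- For a bounded bilinear map `(a, x) ↦ a • x`, the bounded map
`x ⊗ a_1 ⊗ ⋯ ⊗ a_{n+1} ↦ (a_1 • x) ⊗ a_2 ⊗ ⋯ ⊗ a_{n+1}`. -/
def actFirst (act : A →L[ℂ] M →L[ℂ] M) (n : ℕ) : PreChain A M (n + 1) →L[ℂ] Chain A M n :=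
  let ι : M →L[ℂ] ContinuousMultilinearMap ℂ (fun _ : Fin n => A) (Chain A M n) :=
    (compContinuousMultilinearMapL ℂ _ _ _).flip (PiTensorProduct.tprodL ℂ)
      ∘L compL ℂ (TPow A n) (PreChain A M n) (Chain A M n) Completion.toComplL
      ∘L ProjTensor.mk M (TPow A n)
  let curry := continuousMultilinearCurryLeftEquiv ℂ (fun _ : Fin (n + 1) => A) (Chain A M n)
  let lft := PiTensorProduct.liftIsometry ℂ (fun _ : Fin (n + 1) => A) (Chain A M n)
  ProjTensor.lift
    (lft.toContinuousLinearEquiv.toContinuousLinearMap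
      ∘L curry.symm.toContinuousLinearEquiv.toContinuousLinearMap
      ∘L compL ℂ A M _ ι ∘L act.flip)

lemma actFirst_pure (act : A →L[ℂ] M →L[ℂ] M) (n : ℕ) (x : M) (a : Fin (n + 1) → A) :
    actFirst act n (ProjTensor.tmul x (tpure a))
      = (ProjTensor.tmul (act (a 0) x) (tpure (Fin.tail a)) : PreChain A M n) := by
  simp [actFirst]
  rfl

variable (A M)

/-- The operator `id ⊗ e` on chains, for `e` in the group algebra of the symmetric group. -/
def chainAction (n : ℕ) (e : MonoidAlgebra ℂ (Equiv.Perm (Fin n))) :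
    Chain A M n →L[ℂ] Chain A M n :=
  (ProjTensor.map (.id ℂ M) (algAction A n e)).completion

/-- The Harrison chains of degree `n`: the range of `id ⊗ e_n^{(1)}`. -/
def harrisonChains (n : ℕ) : Submodule ℂ (Chain A M n) :=
  LinearMap.range (chainAction A M n (bgs n 1)).toLinearMap

variable [IsScalarTower ℂ A A] [SMulCommClass ℂ A A] [BanachBimodule A M]

/-- The Hochschild boundary on `M ⊗ A^{⊗ (n+1)}`: the alternating sum of
`x ⊗ a_1 ⊗ ⋯ ↦ x a_1 ⊗ a_2 ⊗ ⋯`, of the maps multiplying two neighbours, and of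
`x ⊗ a_1 ⊗ ⋯ ⊗ a_{n+1} ↦ a_{n+1} x ⊗ a_1 ⊗ ⋯ ⊗ a_n`. The last one is written with the cyclic
permutation that moves the last factor to the first place. -/
def preBoundary (n : ℕ) : PreChain A M (n + 1) →L[ℂ] Chain A M n :=
  actFirst BanachBimodule.ract n
    + ∑ j : Fin n, (-1 : ℂ) ^ ((j : ℕ) + 1) •
        (Completion.toComplL ∘L ProjTensor.map (.id ℂ M) (merge A j))
    + (-1 : ℂ) ^ (n + 1) • (actFirst BanachBimodule.lact n
        ∘L ProjTensor.map (.id ℂ M) (permAction A (n + 1) (finRotate (n + 1))))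

/-- The Hochschild boundary `d_n : C_{n+1}(A, M) → C_n(A, M)`. -/
def boundary (n : ℕ) : Chain A M (n + 1) →L[ℂ] Chain A M n :=
  (preBoundary A M n).fromCompletion

variable {A M} in
lemma boundary_pure (n : ℕ) (x : M) (a : Fin (n + 1) → A) :
    boundary A M n (ProjTensor.tmul x (tpure a) : PreChain A M (n + 1))
      = ((ProjTensor.tmul (BanachBimodule.ract (a 0) x) (tpure (Fin.tail a))
        + ∑ j : Fin n, (-1 : ℂ) ^ ((j : ℕ) + 1) •
            ProjTensor.tmul x (tpure (Fin.contractNth j.castSucc (· * ·) a))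
        + (-1 : ℂ) ^ (n + 1) •
            ProjTensor.tmul (BanachBimodule.lact (a (Fin.last n)) x) (tpure (Fin.init a)) :
          PreChain A M n) : Chain A M n) := by
  have hr : ∀ k : Fin n, (finRotate (n + 1)).symm k.succ = k.castSucc := fun k => by
    rw [Equiv.symm_apply_eq, finRotate_apply, Fin.coeSucc_eq_succ]
  have h0 : (a ∘ ⇑(finRotate (n + 1))⁻¹) 0 = a (Fin.last n) := by
    have : (finRotate (n + 1)).symm 0 = Fin.last n := by
      rw [Equiv.symm_apply_eq, finRotate_last]
    rw [Equiv.Perm.inv_def, Function.comp_apply, this]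
  have h1 : Fin.tail (a ∘ ⇑(finRotate (n + 1))⁻¹) = Fin.init a := by
    funext k
    rw [Equiv.Perm.inv_def, Fin.tail, Function.comp_apply, hr, Fin.init]
  rw [boundary, fromCompletion_apply_coe]
  simp only [← Completion.coe_toComplL (𝕜 := ℂ), map_add, map_sum, map_smul]
  simp only [preBoundary, add_apply, sum_apply, smul_apply, actFirst_pure, comp_apply,
    ProjTensor.map_tmul, id_apply, permAction_pure, merge_pure, h0, h1]
  rfl

/-- The Harrison cycles of degree `n`. -/
def harrisonCycles : (n : ℕ) → Submodule ℂ (Chain A M n)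
  | 0 => harrisonChains A M 0
  | n + 1 => harrisonChains A M (n + 1) ⊓ LinearMap.ker (boundary A M n).toLinearMap

/-- The Harrison boundaries of degree `n`: the image of the Harrison chains of degree `n + 1`. -/
def harrisonBoundaries (n : ℕ) : Submodule ℂ (Chain A M n) :=
  (harrisonChains A M (n + 1)).map (boundary A M n).toLinearMap

/-- The Harrison homology of `(A, M)`, with its quotient seminorm. -/
abbrev HarrisonHomology (n : ℕ) : Type _ :=
  harrisonCycles A M n ⧸ (harrisonBoundaries A M n).submoduleOf (harrisonCycles A M n)

variable {A M}

/-- The homology class of a Harrison cycle. -/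
def homologyClass {n : ℕ} (z : harrisonCycles A M n) : HarrisonHomology A M n :=
  Submodule.Quotient.mk z

end Chains

section ChainMaps

variable {A : Type*} [NonUnitalNormedCommRing A] [NormedSpace ℂ A]
  {M : Type*} [NormedAddCommGroup M] [NormedSpace ℂ M]
  {N : Type*} [NormedAddCommGroup N] [NormedSpace ℂ N]

variable (A) in
/-- The map `f ⊗ id` on chains. -/
def chainMap (f : M →L[ℂ] N) (n : ℕ) : Chain A M n →L[ℂ] Chain A N n :=
  (ProjTensor.map f (.id ℂ (TPow A n))).completion

lemma completion_comm {X Y Z W : Type*} [SeminormedAddCommGroup X] [NormedSpace ℂ X]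
    [SeminormedAddCommGroup Y] [NormedSpace ℂ Y] [SeminormedAddCommGroup Z] [NormedSpace ℂ Z]
    [SeminormedAddCommGroup W] [NormedSpace ℂ W]
    {f : X →L[ℂ] Y} {g : Y →L[ℂ] W} {h : X →L[ℂ] Z} {k : Z →L[ℂ] W}
    (e : g ∘L f = k ∘L h) (x : Completion X) :
    g.completion (f.completion x) = k.completion (h.completion x) := by
  induction x using Completion.induction_on with
  | hp => exact isClosed_eq (by fun_prop) (by fun_prop)
  | ih x =>
    simp only [completion_apply_coe]
    exact congrArg _ (congrArg (fun u : X →L[ℂ] W => u x) e)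

lemma chainMap_chainAction (f : M →L[ℂ] N) (n : ℕ) (e : MonoidAlgebra ℂ (Equiv.Perm (Fin n)))
    (c : Chain A M n) :
    chainMap A f n (chainAction A M n e c) = chainAction A N n e (chainMap A f n c) :=
  completion_comm (ProjTensor.ext fun x t => by simp) c

lemma chainMap_mem_harrisonChains (f : M →L[ℂ] N) {n : ℕ} {c : Chain A M n}
    (hc : c ∈ harrisonChains A M n) : chainMap A f n c ∈ harrisonChains A N n := by
  obtain ⟨b, rfl⟩ := hc
  exact ⟨chainMap A f n b, (chainMap_chainAction f n _ b).symm⟩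

variable [IsScalarTower ℂ A A] [SMulCommClass ℂ A A] [BanachBimodule A M] [BanachBimodule A N]

lemma chainMap_boundary (f : BimoduleHom A M N) (n : ℕ) (c : Chain A M (n + 1)) :
    chainMap A f.toContinuousLinearMap n (boundary A M n c)
      = boundary A N n (chainMap A f.toContinuousLinearMap (n + 1) c) := by
  induction c using Completion.induction_on with
  | hp => exact isClosed_eq (by fun_prop) (by fun_prop)
  | ih t =>
    have h : (chainMap A f.toContinuousLinearMap n ∘L boundary A M n) ∘L Completion.toComplL
        = (boundary A N n ∘L chainMap A f.toContinuousLinearMap (n + 1)) ∘L Completion.toComplL :=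
      preChain_ext fun x a => by
        simp [boundary_pure, chainMap, f.map_lact, f.map_ract]
    exact congrArg (fun u : PreChain A M (n + 1) →L[ℂ] Chain A N n => u t) h

lemma chainMap_mem_harrisonCycles (f : BimoduleHom A M N) {n : ℕ} {c : Chain A M n}
    (hc : c ∈ harrisonCycles A M n) :
    chainMap A f.toContinuousLinearMap n c ∈ harrisonCycles A N n := by
  cases n with
  | zero => exact chainMap_mem_harrisonChains _ hc
  | succ n =>
    refine ⟨chainMap_mem_harrisonChains _ hc.1, ?_⟩
    have h : boundary A M n c = 0 := hc.2
    change boundary A N n _ = 0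
    rw [← chainMap_boundary, h, map_zero]

/-- The map induced on Harrison cycles. -/
def cyclesMap (f : BimoduleHom A M N) (n : ℕ) : harrisonCycles A M n →L[ℂ] harrisonCycles A N n :=
  (chainMap A f.toContinuousLinearMap n).restrict fun _ => chainMap_mem_harrisonCycles f

/-- The map induced on Harrison homology. -/
def homologyMap (f : BimoduleHom A M N) (n : ℕ) :
    HarrisonHomology A M n →L[ℂ] HarrisonHomology A N n :=
  Submodule.liftQL _ (Submodule.mkQL _ ∘L cyclesMap f n) <| by
    rintro ⟨z, hz⟩ ⟨b, hb, h⟩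
    refine (Submodule.Quotient.mk_eq_zero _).2 ⟨chainMap A f.toContinuousLinearMap (n + 1) b,
      chainMap_mem_harrisonChains _ hb, ?_⟩
    change boundary A M n b = z at h
    subst h
    exact (chainMap_boundary f n b).symm

lemma homologyMap_class (f : BimoduleHom A M N) {n : ℕ} (z : harrisonCycles A M n) :
    homologyMap f n (homologyClass z) = homologyClass (cyclesMap f n z) := rfl

end ChainMaps

/-! ## Hochschild cochains -/

section Cochains

variable (A : Type*) [NonUnitalNormedCommRing A] [NormedSpace ℂ A]
  (M : Type*) [NormedAddCommGroup M] [NormedSpace ℂ M]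

/-- The Hochschild cochains: bounded `n`-linear maps `A × ⋯ × A → M`. -/
abbrev Cochain (n : ℕ) : Type _ := ContinuousMultilinearMap ℂ (fun _ : Fin n => A) M

variable {A} in
/-- Precomposition of cochains with an operator `T` between tensor powers, using that bounded
`n`-linear maps are the bounded linear maps on the `n`-fold projective tensor power. -/
def precomp {m n : ℕ} (T : TPow A m →L[ℂ] TPow A n) : Cochain A M n →L[ℂ] Cochain A M m :=
  let lm := (PiTensorProduct.liftIsometry ℂ (fun _ : Fin m => A) M).toContinuousLinearEquiv
  let ln := (PiTensorProduct.liftIsometry ℂ (fun _ : Fin n => A) M).toContinuousLinearEquiv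
  lm.symm.toContinuousLinearMap ∘L (compL ℂ (TPow A m) (TPow A n) M).flip T ∘L ln.toContinuousLinearMap

variable {A M} in
lemma precomp_apply {m n : ℕ} (T : TPow A m →L[ℂ] TPow A n) (ψ : Cochain A M n) (a : Fin m → A) :
    precomp M T ψ a = PiTensorProduct.lift ψ.toMultilinearMap (T (tpure a)) := by
  simp [precomp]

/-- The operator "precomposition with `e`" on cochains, for `e` in the group algebra of the
symmetric group. -/
def cochainAction (n : ℕ) (e : MonoidAlgebra ℂ (Equiv.Perm (Fin n))) :
    Cochain A M n →L[ℂ] Cochain A M n :=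
  precomp M (algAction A n e)

/-- The Harrison cochains of degree `n`: the range of precomposition with `e_n^{(1)}`. -/
def harrisonCochains (n : ℕ) : Submodule ℂ (Cochain A M n) :=
  LinearMap.range (cochainAction A M n (bgs n 1)).toLinearMap

variable [IsScalarTower ℂ A A] [SMulCommClass ℂ A A] [BanachBimodule A M]

/-- The term `(a_1, …, a_{n+1}) ↦ a_1 · ψ(a_2, …, a_{n+1})` of the coboundary. -/
def coboundaryFirst (n : ℕ) : Cochain A M n →L[ℂ] Cochain A M (n + 1) :=
  let curry := continuousMultilinearCurryLeftEquiv ℂ (fun _ : Fin (n + 1) => A) M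
  curry.symm.toContinuousLinearEquiv.toContinuousLinearMap ∘L
    (compContinuousMultilinearMapL ℂ (fun _ : Fin n => A) M M
      ∘L BanachBimodule.lact (A := A) (M := M)).flip

/-- The term `(a_1, …, a_{n+1}) ↦ ψ(a_1, …, a_n) · a_{n+1}` of the coboundary. -/
def coboundaryLast (n : ℕ) : Cochain A M n →L[ℂ] Cochain A M (n + 1) :=
  let curry := continuousMultilinearCurryRightEquiv ℂ (fun _ : Fin (n + 1) => A) M
  curry.symm.toContinuousLinearEquiv.toContinuousLinearMap ∘L
    compContinuousMultilinearMapL ℂ (fun _ : Fin n => A) M (A →L[ℂ] M)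
      (BanachBimodule.ract (A := A) (M := M)).flip

/-- The Hochschild coboundary `δ^n : C^n(A, M) → C^{n+1}(A, M)`. -/
def coboundary (n : ℕ) : Cochain A M n →L[ℂ] Cochain A M (n + 1) :=
  coboundaryFirst A M n
    + ∑ j : Fin n, (-1 : ℂ) ^ ((j : ℕ) + 1) • precomp M (merge A j)
    + (-1 : ℂ) ^ (n + 1) • coboundaryLast A M n

variable {A M} in
lemma coboundary_apply (n : ℕ) (ψ : Cochain A M n) (a : Fin (n + 1) → A) :
    coboundary A M n ψ a
      = BanachBimodule.lact (a 0) (ψ (Fin.tail a))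
        + ∑ j : Fin n, (-1 : ℂ) ^ ((j : ℕ) + 1) • ψ (Fin.contractNth j.castSucc (· * ·) a)
        + (-1 : ℂ) ^ (n + 1) • BanachBimodule.ract (a (Fin.last n)) (ψ (Fin.init a)) := by
  have h0 : coboundaryFirst A M n ψ a = BanachBimodule.lact (a 0) (ψ (Fin.tail a)) := by
    simp [coboundaryFirst]
    rfl
  have h1 : coboundaryLast A M n ψ a
      = BanachBimodule.ract (a (Fin.last n)) (ψ (Fin.init a)) := by
    simp [coboundaryLast]
    rfl
  simp only [coboundary, add_apply, sum_apply, smul_apply, h0, h1,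
    precomp_apply, merge_pure, PiTensorProduct.lift.tprod]
  rfl

/-- The Harrison cocycles of degree `n`. -/
def harrisonCocycles (n : ℕ) : Submodule ℂ (Cochain A M n) :=
  harrisonCochains A M n ⊓ LinearMap.ker (coboundary A M n).toLinearMap

/-- The Harrison coboundaries of degree `n`: the image of the Harrison cochains of degree
`n - 1`. -/
def harrisonCoboundaries : (n : ℕ) → Submodule ℂ (Cochain A M n)
  | 0 => ⊥
  | n + 1 => (harrisonCochains A M n).map (coboundary A M n).toLinearMap

/-- The Harrison cohomology of `(A, M)`, with its quotient seminorm. -/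
abbrev HarrisonCohomology (n : ℕ) : Type _ :=
  harrisonCocycles A M n ⧸ (harrisonCoboundaries A M n).submoduleOf (harrisonCocycles A M n)

variable {A M}

/-- The cohomology class of a Harrison cocycle. -/
def cohomologyClass {n : ℕ} (z : harrisonCocycles A M n) : HarrisonCohomology A M n :=
  Submodule.Quotient.mk z

end Cochains

section CochainMaps

variable {A : Type*} [NonUnitalNormedCommRing A] [NormedSpace ℂ A]
  {M : Type*} [NormedAddCommGroup M] [NormedSpace ℂ M]
  {N : Type*} [NormedAddCommGroup N] [NormedSpace ℂ N]

variable (A) in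
/-- The map `ψ ↦ f ∘ ψ` on cochains. -/
def cochainMap (f : M →L[ℂ] N) (n : ℕ) : Cochain A M n →L[ℂ] Cochain A N n :=
  compContinuousMultilinearMapL ℂ (fun _ : Fin n => A) M N f

@[simp] lemma cochainMap_apply (f : M →L[ℂ] N) (n : ℕ) (ψ : Cochain A M n) (a : Fin n → A) :
    cochainMap A f n ψ a = f (ψ a) := rfl

lemma cochainMap_precomp (f : M →L[ℂ] N) {m n : ℕ} (T : TPow A m →L[ℂ] TPow A n)
    (ψ : Cochain A M n) :
    cochainMap A f m (precomp M T ψ) = precomp N T (cochainMap A f n ψ) := by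
  ext a
  rw [cochainMap_apply, precomp_apply, precomp_apply]
  have : f.toLinearMap ∘ₗ PiTensorProduct.lift ψ.toMultilinearMap
      = PiTensorProduct.lift (cochainMap A f n ψ).toMultilinearMap :=
    PiTensorProduct.ext (MultilinearMap.ext fun b => by simp [cochainMap])
  exact congrArg (fun u : TPow A n →ₗ[ℂ] N => u (T (tpure a))) this

lemma cochainMap_mem_harrisonCochains (f : M →L[ℂ] N) {n : ℕ} {c : Cochain A M n}
    (hc : c ∈ harrisonCochains A M n) : cochainMap A f n c ∈ harrisonCochains A N n := by
  obtain ⟨b, rfl⟩ := hc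
  exact ⟨cochainMap A f n b, (cochainMap_precomp f _ b).symm⟩

variable [IsScalarTower ℂ A A] [SMulCommClass ℂ A A] [BanachBimodule A M] [BanachBimodule A N]

lemma cochainMap_coboundary (f : BimoduleHom A M N) (n : ℕ) (c : Cochain A M n) :
    cochainMap A f.toContinuousLinearMap (n + 1) (coboundary A M n c)
      = coboundary A N n (cochainMap A f.toContinuousLinearMap n c) := by
  ext a
  simp [coboundary_apply, f.map_lact, f.map_ract]

lemma cochainMap_mem_harrisonCocycles (f : BimoduleHom A M N) {n : ℕ} {c : Cochain A M n}
    (hc : c ∈ harrisonCocycles A M n) :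
    cochainMap A f.toContinuousLinearMap n c ∈ harrisonCocycles A N n := by
  refine ⟨cochainMap_mem_harrisonCochains _ hc.1, ?_⟩
  have h : coboundary A M n c = 0 := hc.2
  change coboundary A N n _ = 0
  rw [← cochainMap_coboundary, h, map_zero]

/-- The map induced on Harrison cocycles. -/
def cocyclesMap (f : BimoduleHom A M N) (n : ℕ) :
    harrisonCocycles A M n →L[ℂ] harrisonCocycles A N n :=
  (cochainMap A f.toContinuousLinearMap n).restrict fun _ => cochainMap_mem_harrisonCocycles f

/-- The map induced on Harrison cohomology. -/
def cohomologyMap (f : BimoduleHom A M N) (n : ℕ) :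
    HarrisonCohomology A M n →L[ℂ] HarrisonCohomology A N n :=
  Submodule.liftQL _ (Submodule.mkQL _ ∘L cocyclesMap f n) <| by
    rintro ⟨z, hz⟩ h
    refine (Submodule.Quotient.mk_eq_zero _).2 ?_
    change cochainMap A f.toContinuousLinearMap n z ∈ harrisonCoboundaries A N n
    change z ∈ harrisonCoboundaries A M n at h
    cases n with
    | zero =>
      have h0 : z = 0 := h
      rw [h0, map_zero]
      exact zero_mem _
    | succ n =>
      obtain ⟨b, hb, rfl⟩ := h
      exact ⟨cochainMap A f.toContinuousLinearMap n b, cochainMap_mem_harrisonCochains _ hb,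
        (cochainMap_coboundary f n b).symm⟩

lemma cohomologyMap_class (f : BimoduleHom A M N) {n : ℕ} (z : harrisonCocycles A M n) :
    cohomologyMap f n (cohomologyClass z) = cohomologyClass (cocyclesMap f n z) := rfl

end CochainMaps

end HarrisonBanach

end

open scoped TensorProduct

noncomputable section

namespace HarrisonBanach

/-! Two things have to be shown: the Harrison chains and cochains are stable under the Hochschild
differential, and a linear splitting of the coefficients splits them in every degree. The rest is
the snake lemma with explicit formulas.

For stability, a chain or cochain is read as a function of words in `A`. The operator `s_n + 2` then
cuts a word into two parts in all possible ways and shuffles the parts with signs. Over a symmetric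
bimodule the differential has one action on both end letters. It is a derivation for the signed
shuffle product because `A` is commutative: merging two letters from different words occurs in both
orders with opposite signs. It is compatible with cutting because the unwanted end faces at the cut
cancel. So `s` commutes with the differential (`Word.splitSum_shuffleSum_barDifferential`,
`permOp_shuffleElement_tupleDifferential`).

The range of `e_n^{(1)}` is the kernel of `s_n` (`mem_harrisonChains_iff`,
`mem_harrisonCochains_iff`): `e_n^{(1)}` is a polynomial in `s_n` with constant term `1`, and `s_n
e_n^{(1)} = 0`. The last equation says that `∏ (X - (2^j - 2))`, over `1 ≤ j ≤ n`, annihilates `s_n`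
(`aeval_shuffleElement_nodal`). This goes by induction: the product for `n`, evaluated at `s_{n+1}`,
kills the universal inner boundary, hence is a multiple of the antisymmetrizer
(`eq_smul_antisymmetrizer`), on which `s_{n+1}` acts by the number `2^{n+1} - 2` of its shuffles.
Kernels of operators commuting with the differential form a subcomplex.

The splitting maps `r` and `s` are not module maps, but they act on the coefficients only, so they
preserve Harrison chains and cochains. The connecting map is induced by the bounded operator `r d
s`; any other lift `m` of a cycle changes the result by `d (r m)` (`Splitting.eq_connecting_add`).
The sequences end at degree one because the differential between degrees zero and one vanishes for
symmetric coefficients. -/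

/-! ## Words, shuffles and the bar differential -/

namespace Word

section Defs

variable {A G : Type*} [AddCommGroup G] [Module ℂ G]

/-- The signed sum of the values of `F` on all shuffles of the words `u` and `v`. -/
def shuffleSum (F : List A → G) : List A → List A → G
  | [], v => F v
  | a :: u, [] => F (a :: u)
  | a :: u, b :: v =>
    shuffleSum (fun w => F (a :: w)) u (b :: v)
      + (-1 : ℂ) ^ (u.length + 1) • shuffleSum (fun w => F (b :: w)) (a :: u) v
  termination_by u v => u.length + v.length

/-- The sum of the values of `H` on all decompositions of a word into two consecutive parts. -/
def splitSum (H : List A → List A → G) : List A → G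
  | [] => H [] []
  | a :: w => H [] (a :: w) + splitSum (fun u v => H (a :: u) v) w

/-- The operation removing the first letter. -/
def leftFace (T : A → List A → G) : List A → G
  | [] => 0
  | a :: w => T a w

/-- The value `g` at the empty word and `0` elsewhere. -/
def atNil (g : G) : List A → G
  | [] => g
  | _ :: _ => 0

/-- The alternating sum over all multiplications of two neighbouring letters. -/
def innerFaces [Mul A] (T : List A → G) : List A → G
  | [] => 0
  | a :: w => -leftFace (fun c w' => T (a * c :: w')) w - innerFaces (fun w' => T (a :: w')) w

/-- The signed operation removing the last letter. -/
def rightFace (T : A → List A → G) : List A → G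
  | [] => 0
  | a :: w => -atNil (T a []) w - rightFace (fun c w' => T c (a :: w')) w

end Defs

variable {A G : Type*} [AddCommGroup G] [Module ℂ G]

/-! ### Linearity and sign rules for the operations on words -/

@[simp] lemma shuffleSum_nil_left (F : List A → G) (v : List A) : shuffleSum F [] v = F v := by
  rw [shuffleSum]

@[simp] lemma shuffleSum_nil_right (F : List A → G) (u : List A) : shuffleSum F u [] = F u := by
  cases u <;> rw [shuffleSum]

lemma shuffleSum_cons_cons (F : List A → G) (a b : A) (u v : List A) :
    shuffleSum F (a :: u) (b :: v) = shuffleSum (fun w => F (a :: w)) u (b :: v)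
      + (-1 : ℂ) ^ (u.length + 1) • shuffleSum (fun w => F (b :: w)) (a :: u) v := by
  rw [shuffleSum]

/-- Induction on two words, generalizing a function of words. -/
lemma induction₂ {P : List A → List A → Prop} (hl : ∀ v, P [] v) (hr : ∀ u, P u [])
    (h : ∀ a u b v, P u (b :: v) → P (a :: u) v → P (a :: u) (b :: v)) (u v : List A) : P u v := by
  induction u generalizing v with
  | nil => exact hl v
  | cons a u ih =>
    induction v with
    | nil => exact hr _
    | cons b v ih' => exact h a u b v (ih _) ih'

lemma shuffleSum_add (F F' : List A → G) (u v : List A) :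
    shuffleSum (fun w => F w + F' w) u v = shuffleSum F u v + shuffleSum F' u v := by
  induction u, v using induction₂ generalizing F F' with
  | hl v => simp
  | hr u => simp
  | h a u b v h₁ h₂ => simp only [shuffleSum_cons_cons, h₁, h₂]; module

lemma shuffleSum_smul (c : ℂ) (F : List A → G) (u v : List A) :
    shuffleSum (fun w => c • F w) u v = c • shuffleSum F u v := by
  induction u, v using induction₂ generalizing F with
  | hl v => simp
  | hr u => simp
  | h a u b v h₁ h₂ => simp only [shuffleSum_cons_cons, h₁, h₂]; module

lemma shuffleSum_neg (F : List A → G) (u v : List A) :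
    shuffleSum (fun w => -F w) u v = -shuffleSum F u v := by
  simpa using shuffleSum_smul (-1) F u v

lemma shuffleSum_sub (F F' : List A → G) (u v : List A) :
    shuffleSum (fun w => F w - F' w) u v = shuffleSum F u v - shuffleSum F' u v := by
  simp only [sub_eq_add_neg, shuffleSum_add, shuffleSum_neg]

@[simp] lemma shuffleSum_zero (u v : List A) : shuffleSum (fun _ => (0 : G)) u v = 0 := by
  simpa using shuffleSum_smul 0 (fun _ => (0 : G)) u v

omit [Module ℂ G] in
lemma leftFace_add (T T' : A → List A → G) (w : List A) :
    leftFace (fun c w => T c w + T' c w) w = leftFace T w + leftFace T' w := by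
  cases w <;> simp [leftFace]

lemma leftFace_smul (c : ℂ) (T : A → List A → G) (w : List A) :
    leftFace (fun b w => c • T b w) w = c • leftFace T w := by
  cases w <;> simp [leftFace]

/-- The face shortens the word by one letter, so a sign read off after the face has its exponent
shifted by one. This and its two analogues move the length-dependent sign of the shuffle recursion
through a face. -/
lemma leftFace_smul_length (T : A → List A → G) (w : List A) :
    leftFace (fun b w => (-1 : ℂ) ^ (w.length + 1) • T b w) w
      = (-1 : ℂ) ^ w.length • leftFace T w := by
  cases w <;> simp [leftFace]

lemma atNil_smul_length (g : G) (w : List A) :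
    (-1 : ℂ) ^ w.length • atNil g w = atNil g w := by
  cases w <;> simp [atNil]

section Inner

variable [Mul A]

omit [Module ℂ G] in
lemma innerFaces_add (T T' : List A → G) (w : List A) :
    innerFaces (fun w => T w + T' w) w = innerFaces T w + innerFaces T' w := by
  induction w generalizing T T' with
  | nil => simp [innerFaces]
  | cons a w ih => simp only [innerFaces, ih, leftFace_add]; abel

lemma innerFaces_smul (c : ℂ) (T : List A → G) (w : List A) :
    innerFaces (fun w => c • T w) w = c • innerFaces T w := by
  induction w generalizing T with
  | nil => simp [innerFaces]
  | cons a w ih => simp only [innerFaces, ih, leftFace_smul]; module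

lemma innerFaces_smul_length (T : List A → G) (w : List A) :
    innerFaces (fun w => (-1 : ℂ) ^ (w.length + 1) • T w) w
      = (-1 : ℂ) ^ w.length • innerFaces T w := by
  induction w generalizing T with
  | nil => simp [innerFaces]
  | cons a w ih =>
    -- The sign of the first letter is split off, so that the remaining sign has the form required
    -- by the induction hypothesis.
    have h : ∀ w : List A, (-1 : ℂ) ^ ((a :: w).length + 1) • T (a :: w)
        = (-1 : ℂ) • (-1 : ℂ) ^ (w.length + 1) • T (a :: w) := fun w => by
      rw [List.length_cons]; module
    have h' : ∀ (c : A) (w : List A), (-1 : ℂ) ^ ((a * c :: w).length + 1) • T (a * c :: w)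
        = (-1 : ℂ) • (-1 : ℂ) ^ (w.length + 1) • T (a * c :: w) := fun c w => by
      rw [List.length_cons]; module
    simp only [innerFaces, h, h', innerFaces_smul, leftFace_smul, leftFace_smul_length, ih]
    rw [List.length_cons]
    module

end Inner

omit [Module ℂ G] in
lemma rightFace_add (T T' : A → List A → G) (w : List A) :
    rightFace (fun c w => T c w + T' c w) w = rightFace T w + rightFace T' w := by
  induction w generalizing T T' with
  | nil => simp [rightFace]
  | cons a w ih => simp only [rightFace, ih]; cases w <;> simp only [atNil] <;> abel

lemma rightFace_smul (c : ℂ) (T : A → List A → G) (w : List A) :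
    rightFace (fun b w => c • T b w) w = c • rightFace T w := by
  induction w generalizing T with
  | nil => simp [rightFace]
  | cons a w ih => simp only [rightFace, ih]; cases w <;> simp only [atNil] <;> module

lemma rightFace_smul_length (T : A → List A → G) (w : List A) :
    rightFace (fun b w => (-1 : ℂ) ^ (w.length + 1) • T b w) w
      = (-1 : ℂ) ^ w.length • rightFace T w := by
  induction w generalizing T with
  | nil => simp [rightFace]
  | cons a w ih =>
    have h : ∀ (c : A) (w : List A), (-1 : ℂ) ^ ((a :: w).length + 1) • T c (a :: w)
        = (-1 : ℂ) • (-1 : ℂ) ^ (w.length + 1) • T c (a :: w) := fun c w => by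
      rw [List.length_cons]; module
    simp only [rightFace, h, rightFace_smul, ih]
    cases w <;> simp [atNil] <;> module

omit [Module ℂ G] in
lemma splitSum_add (H H' : List A → List A → G) (w : List A) :
    splitSum (fun u v => H u v + H' u v) w = splitSum H w + splitSum H' w := by
  induction w generalizing H H' with
  | nil => rfl
  | cons a w ih => simp only [splitSum, ih]; abel

lemma splitSum_smul (c : ℂ) (H : List A → List A → G) (w : List A) :
    splitSum (fun u v => c • H u v) w = c • splitSum H w := by
  induction w generalizing H with
  | nil => rfl
  | cons a w ih => simp only [splitSum, ih, smul_add]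

lemma splitSum_neg (H : List A → List A → G) (w : List A) :
    splitSum (fun u v => -H u v) w = -splitSum H w := by
  simpa using splitSum_smul (-1) H w

/-! ### The faces are derivations of the shuffle product -/

/-- A shuffle starts with the first letter of `u` or with that of `v`; the latter has passed all of
`u`, hence the sign. -/
lemma shuffleSum_leftFace (T : A → List A → G) (u v : List A) :
    shuffleSum (leftFace T) u v = leftFace (fun c u' => shuffleSum (T c) u' v) u
      + (-1 : ℂ) ^ u.length • leftFace (fun c v' => shuffleSum (T c) u v') v := by
  cases u <;> cases v <;> simp [shuffleSum_cons_cons, leftFace]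

lemma shuffleSum_atNil_cons (g : G) (u v : List A) (b : A) :
    shuffleSum (atNil g) u (b :: v) = 0 := by
  cases u <;> simp [shuffleSum_cons_cons, atNil]

lemma shuffleSum_atNil_cons_left (g : G) (u v : List A) (a : A) :
    shuffleSum (atNil g) (a :: u) v = 0 := by
  cases v <;> simp [shuffleSum_cons_cons, atNil]

/-- Neighbours in a shuffle that come from the same word give the faces of that word. Neighbours
from different words occur in both orders with opposite signs, and their products agree by
commutativity. -/
lemma shuffleSum_innerFaces [CommMagma A] (T : List A → G) (u v : List A) :
    shuffleSum (innerFaces T) u v = innerFaces (fun u' => shuffleSum T u' v) u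
      + (-1 : ℂ) ^ u.length • innerFaces (fun v' => shuffleSum T u v') v := by
  induction u, v using induction₂ generalizing T with
  | hl v => simp [innerFaces]
  | hr u => simp [innerFaces]
  | h a u b v h₁ h₂ =>
    simp only [shuffleSum_cons_cons, innerFaces, shuffleSum_sub, shuffleSum_neg, h₁, h₂,
      shuffleSum_leftFace, leftFace_add, leftFace_smul, innerFaces_add, innerFaces_smul,
      innerFaces_smul_length, leftFace_smul_length, List.length_cons]
    -- The two mixed terms, containing `a * b` and `b * a`, become equal and cancel.
    simp only [leftFace, mul_comm b a]
    module

lemma shuffleSum_rightFace (T : A → List A → G) (u v : List A) :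
    shuffleSum (rightFace T) u v = rightFace (fun c u' => shuffleSum (T c) u' v) u
      + (-1 : ℂ) ^ u.length • rightFace (fun c v' => shuffleSum (T c) u v') v := by
  induction u, v using induction₂ generalizing T with
  | hl v => simp [rightFace]
  | hr u => simp [rightFace]
  | h a u b v h₁ h₂ =>
    -- The letter `a` is the last one of its word only when `u` is empty, and then the sign `(-1) ^
    -- u.length` is `1`.
    have h := atNil_smul_length (T a (b :: v)) u
    simp only [shuffleSum_cons_cons, rightFace, shuffleSum_sub, shuffleSum_neg, h₁, h₂,
      shuffleSum_atNil_cons, shuffleSum_atNil_cons_left, rightFace_add, rightFace_smul,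
      rightFace_smul_length, List.length_cons, shuffleSum_nil_left, shuffleSum_nil_right]
    linear_combination (norm := module) -h

/-! ### The faces are coderivations of deconcatenation -/

omit [Module ℂ G] in
lemma splitSum_leftFace_left (K : A → List A → List A → G) (w : List A) :
    splitSum (fun u v => leftFace (fun c u' => K c u' v) u) w
      = leftFace (fun c => splitSum (K c)) w := by
  cases w <;> simp [splitSum, leftFace]

lemma splitSum_atNil (g : List A → G) (w : List A) :
    splitSum (fun u v => atNil (g v) u) w = g w := by
  have h : ∀ w : List A, splitSum (fun _ _ => (0 : G)) w = 0 := fun w => by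
    simpa using splitSum_smul 0 (fun _ _ => (0 : G)) w
  cases w <;> simp [splitSum, atNil, h]

/-- Cutting a word after a merge never separates the merged letters, so the merge takes place inside
one of the parts; in the second part its position is shifted by the length of the first. -/
lemma splitSum_innerFaces [Mul A] (H : List A → List A → G) (w : List A) :
    splitSum (fun u v => innerFaces (fun u' => H u' v) u
      + (-1 : ℂ) ^ u.length • innerFaces (H u) v) w = innerFaces (splitSum H) w := by
  induction w generalizing H with
  | nil => simp [splitSum, innerFaces]
  | cons a w ih =>
    have h := ih (fun u v => H (a :: u) v)
    simp only [splitSum, innerFaces, List.length_cons, pow_succ, mul_neg_one, neg_smul,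
      sub_eq_add_neg, splitSum_add, splitSum_neg, splitSum_leftFace_left, leftFace_add,
      innerFaces_add, List.length_nil, pow_zero, one_smul] at h ⊢
    rw [← h]
    module

/-- Removing `c` as the first letter of the second part, from the cut `u | c v`, leaves the same
data as removing it as the last letter of the first part, from `u c | v`, with the opposite sign.
Both faces must act through the same `K`, which is the role of symmetric coefficients. -/
lemma splitSum_cancel (K : A → List A → List A → G) (w : List A) :
    splitSum (fun u v => (-1 : ℂ) ^ u.length • leftFace (fun c v' => K c u v') v) w
      + splitSum (fun u v => rightFace (fun c u' => K c u' v) u) w = 0 := by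
  induction w generalizing K with
  | nil => simp [splitSum, leftFace, rightFace]
  | cons a w ih =>
    have h := ih (fun c u v => K c (a :: u) v)
    have h₀ : leftFace (fun c v' => K c [] v') (a :: w) = K a [] w := rfl
    simp only [splitSum, h₀, rightFace, List.length_cons, pow_succ, mul_neg_one, neg_smul,
      sub_eq_add_neg,
      splitSum_add, splitSum_neg, splitSum_atNil, List.length_nil, pow_zero, one_smul]
    linear_combination (norm := module) -h

lemma splitSum_rightFace_right (K : A → List A → List A → G) (w : List A) :
    splitSum (fun u v => (-1 : ℂ) ^ u.length • rightFace (fun c v' => K c u v') v) w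
      = rightFace (fun c => splitSum (K c)) w := by
  induction w generalizing K with
  | nil => simp [splitSum, rightFace]
  | cons a w ih =>
    have h := ih (fun c u v => K c (a :: u) v)
    simp only [splitSum, rightFace, List.length_cons, pow_succ, mul_neg_one, neg_smul,
      sub_eq_add_neg,
      splitSum_neg, rightFace_add, List.length_nil, pow_zero, one_smul, h]
    module

/-- The bar differential with coefficients: removing the first or last letter is seen by `T₁`. -/
def barDifferential [Mul A] (T₀ : List A → G) (T₁ : A → List A → G) (w : List A) : G :=
  leftFace T₁ w + innerFaces T₀ w + rightFace T₁ w

/-- The operator summing over all shuffles of all decompositions of a word into two parts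
commutes with the bar differential. -/
theorem splitSum_shuffleSum_barDifferential [CommMagma A] (T₀ : List A → G)
    (T₁ : A → List A → G) (w : List A) :
    splitSum (shuffleSum (barDifferential T₀ T₁)) w
      = barDifferential (splitSum (shuffleSum T₀)) (fun c => splitSum (shuffleSum (T₁ c))) w := by
  have h : shuffleSum (barDifferential T₀ T₁) = fun u v =>
      (leftFace (fun c u' => shuffleSum (T₁ c) u' v) u
        + (-1 : ℂ) ^ u.length • leftFace (fun c v' => shuffleSum (T₁ c) u v') v)
      + (innerFaces (fun u' => shuffleSum T₀ u' v) u
        + (-1 : ℂ) ^ u.length • innerFaces (fun v' => shuffleSum T₀ u v') v)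
      + (rightFace (fun c u' => shuffleSum (T₁ c) u' v) u
        + (-1 : ℂ) ^ u.length • rightFace (fun c v' => shuffleSum (T₁ c) u v') v) := by
    funext u v
    rw [← shuffleSum_leftFace, ← shuffleSum_innerFaces, ← shuffleSum_rightFace,
      ← shuffleSum_add, ← shuffleSum_add]
    rfl
  -- These are the faces at the cut. The outer ones, left on the first part and right on the second,
  -- survive as faces of the whole word.
  have h₁ := splitSum_cancel (fun c u v => shuffleSum (T₁ c) u v) w
  have h₂ := splitSum_innerFaces (fun u v => shuffleSum T₀ u v) w
  rw [splitSum_add] at h₂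
  rw [h]
  simp only [splitSum_add, splitSum_leftFace_left, splitSum_rightFace_right, barDifferential]
  linear_combination (norm := module) h₁ + h₂

end Word

/-! ## Shuffle permutations -/

section Perm

open Equiv

variable {n : ℕ}

/-- The permutation moving `k` to the first place and permuting the other ones by `τ`. -/
def consPerm (k : Fin (n + 1)) (τ : Perm (Fin n)) : Perm (Fin (n + 1)) :=
  Perm.decomposeFin.symm (0, τ) * k.cycleRange

@[simp] lemma consPerm_self (k : Fin (n + 1)) (τ : Perm (Fin n)) : consPerm k τ k = 0 := by
  simp [consPerm]

@[simp] lemma consPerm_succAbove (k : Fin (n + 1)) (τ : Perm (Fin n)) (j : Fin n) :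
    consPerm k τ (k.succAbove j) = (τ j).succ := by
  simp [consPerm]

lemma sign_consPerm (k : Fin (n + 1)) (τ : Perm (Fin n)) :
    Perm.sign (consPerm k τ) = (-1) ^ (k : ℕ) * Perm.sign τ := by
  simp [consPerm, mul_comm]

lemma comp_consPerm_inv {A : Type*} (a : Fin (n + 1) → A) (k : Fin (n + 1)) (τ : Perm (Fin n)) :
    a ∘ ⇑(consPerm k τ)⁻¹ = Fin.cons (a k) (k.removeNth a ∘ ⇑τ⁻¹) := by
  funext j
  refine Fin.cases ?_ (fun j => ?_) j
  · have : (consPerm k τ)⁻¹ 0 = k := by rw [Perm.inv_eq_iff_eq, consPerm_self]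
    simp only [Function.comp_apply, this, Fin.cons_zero]
  · have : (consPerm k τ)⁻¹ j.succ = k.succAbove (τ⁻¹ j) := by
      rw [Perm.inv_eq_iff_eq, consPerm_succAbove]; simp
    simp only [Function.comp_apply, this, Fin.cons_succ, Fin.removeNth]

lemma consPerm_bijective :
    Function.Bijective fun x : Fin (n + 1) × Perm (Fin n) => consPerm x.1 x.2 := by
  refine (Fintype.bijective_iff_injective_and_card _).2 ⟨?_, ?_⟩
  · rintro ⟨k, τ⟩ ⟨k', τ'⟩ h
    have h' : consPerm k τ = consPerm k' τ' := h
    obtain rfl : k = k' := by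
      apply (consPerm k' τ').injective
      rw [consPerm_self, ← h', consPerm_self]
    congr 1
    ext1 j
    have := congrArg (fun σ : Perm (Fin (n + 1)) => σ (k.succAbove j)) h'
    simpa using this
  · simp [Fintype.card_perm, Nat.factorial_succ]

/-- What a shuffle moves to the first place is the initial entry of one of the two blocks, so it has
index `0` or `p`. Deleting it shortens the first block in the former case only. The condition `0 <
p` keeps the cases apart when the first block is empty. -/
lemma isShuffle_consPerm (p : ℕ) (k : Fin (n + 1)) (τ : Perm (Fin n)) :
    IsShuffle p (consPerm k τ) ↔
      (k = 0 ∧ 0 < p ∧ IsShuffle (p - 1) τ) ∨ ((k : ℕ) = p ∧ IsShuffle p τ) := by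
  have hval : ∀ j : Fin n, ((k.succAbove j : Fin (n + 1)) : ℕ) = if (j : ℕ) < k then (j : ℕ)
      else j + 1 := fun j => by
    rw [Fin.succAbove]
    simp only [Fin.lt_def, Fin.val_castSucc]
    split_ifs <;> simp
  constructor
  · rintro ⟨h₁, h₂⟩
    have hk : k = 0 ∧ 0 < p ∨ (k : ℕ) = p := by
      by_contra! hne
      rcases lt_or_ge (k : ℕ) p with hp | hp
      · have h0 : 0 < k := by
          rw [Fin.pos_iff_ne_zero]
          intro h
          have := hne.1 h
          omega
        have := h₁ 0 k h0 hp
        rw [consPerm_self] at this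
        exact absurd this (Fin.not_lt_zero _)
      · have := h₂ ⟨p, by omega⟩ k (by rw [Fin.lt_def]; simp only; omega) le_rfl
        rw [consPerm_self] at this
        exact absurd this (Fin.not_lt_zero _)
    -- Here `r` is the size of the first block after deleting `k`; since `k.succAbove` is
    -- increasing, only the block boundaries need checking.
    have hτ : ∀ r : ℕ, (∀ i j : Fin n, i < j → (j : ℕ) < r →
          ((k.succAbove j : Fin (n + 1)) : ℕ) < p) →
        (∀ i j : Fin n, i < j → r ≤ (i : ℕ) → p ≤ ((k.succAbove i : Fin (n + 1)) : ℕ)) →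
        IsShuffle r τ := by
      refine fun r hr₁ hr₂ => ⟨fun i j hij hj => ?_, fun i j hij hi => ?_⟩
      · have := h₁ (k.succAbove i) (k.succAbove j) (Fin.strictMono_succAbove k hij)
          (hr₁ i j hij hj)
        simpa using this
      · have := h₂ (k.succAbove i) (k.succAbove j) (Fin.strictMono_succAbove k hij)
          (hr₂ i j hij hi)
        simpa using this
    rcases hk with ⟨rfl, hp⟩ | hk
    · refine Or.inl ⟨rfl, hp, hτ _ (fun i j hij hj => ?_) fun i j hij hi => ?_⟩
      · rw [hval]; simp; omega
      · rw [hval]; simp; omega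
    · refine Or.inr ⟨hk, hτ _ (fun i j hij hj => ?_) fun i j hij hi => ?_⟩
      · rw [hval, if_pos (by omega)]; omega
      · rw [hval, if_neg (by omega)]; omega
  · intro h
    have key : ∀ r : ℕ, IsShuffle r τ → (∀ x y : Fin (n + 1), x < y → (y : ℕ) < p → y ≠ k) →
        (∀ x y : Fin (n + 1), x < y → p ≤ (x : ℕ) → y ≠ k) →
        (∀ j : Fin n, ((k.succAbove j : Fin (n + 1)) : ℕ) < p ↔ (j : ℕ) < r) →
        IsShuffle p (consPerm k τ) := by
      refine fun r hτ hk₁ hk₂ hr => ⟨fun x y hxy hy => ?_, fun x y hxy hx => ?_⟩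
      · obtain ⟨j, rfl⟩ := Fin.exists_succAbove_eq (hk₁ x y hxy hy)
        rcases eq_or_ne x k with rfl | hxk
        · simp
        · obtain ⟨i, rfl⟩ := Fin.exists_succAbove_eq hxk
          simpa using hτ.1 i j (by simpa using hxy) ((hr j).1 hy)
      · obtain ⟨j, rfl⟩ := Fin.exists_succAbove_eq (hk₂ x y hxy hx)
        rcases eq_or_ne x k with rfl | hxk
        · simp
        · obtain ⟨i, rfl⟩ := Fin.exists_succAbove_eq hxk
          have hi := hr i
          simpa using hτ.2 i j (by simpa using hxy) (by omega)
    rcases h with ⟨rfl, hp, hτ⟩ | ⟨rfl, hτ⟩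
    · refine key _ hτ (fun x y hxy _ => ?_) (fun x y hxy _ => ?_) fun j => ?_
      · rintro rfl; exact Fin.not_lt_zero _ hxy
      · rintro rfl; exact Fin.not_lt_zero _ hxy
      · rw [hval]; simp; omega
    · refine key _ hτ (fun x y hxy hy => ?_) (fun x y hxy hx => ?_) fun j => ?_
      · rintro rfl; omega
      · rintro rfl; rw [Fin.lt_def] at hxy; omega
      · rw [hval]; split_ifs <;> omega

open Classical in
/-- Summation over the `(p, n + 1 - p)`-shuffles, according to what is moved to the first place. -/
lemma sum_isShuffle_succ {G : Type*} [AddCommMonoid G] (p : ℕ) (g : Perm (Fin (n + 1)) → G) :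
    ∑ σ : Perm (Fin (n + 1)) with IsShuffle p σ, g σ
      = (if 0 < p then ∑ τ : Perm (Fin n) with IsShuffle (p - 1) τ, g (consPerm 0 τ) else 0)
        + if h : p < n + 1 then ∑ τ : Perm (Fin n) with IsShuffle p τ, g (consPerm ⟨p, h⟩ τ)
          else 0 := by
  rw [Finset.sum_filter, ← consPerm_bijective.sum_comp, Fintype.sum_prod_type]
  have hsplit : ∀ (k : Fin (n + 1)) (τ : Perm (Fin n)),
      (if IsShuffle p (consPerm k τ) then g (consPerm k τ) else 0)
        = (if k = 0 ∧ 0 < p ∧ IsShuffle (p - 1) τ then g (consPerm k τ) else 0)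
          + if (k : ℕ) = p ∧ IsShuffle p τ then g (consPerm k τ) else 0 := by
    intro k τ
    -- The alternatives exclude each other, so the indicator of their disjunction is the sum of the
    -- two indicators.
    rw [isShuffle_consPerm]
    by_cases h₁ : k = 0 ∧ 0 < p ∧ IsShuffle (p - 1) τ
    · have h₂ : ¬((k : ℕ) = p ∧ IsShuffle p τ) := by
        rintro ⟨h, -⟩
        rw [h₁.1] at h
        simp only [Fin.val_zero] at h
        omega
      rw [if_pos (Or.inl h₁), if_pos h₁, if_neg h₂, add_zero]
    · simp [h₁]
  simp only [hsplit, Finset.sum_add_distrib]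
  congr 1
  · rw [Finset.sum_eq_single 0 (by simp +contextual) (by simp)]
    split_ifs with hp <;> simp [hp, Finset.sum_filter]
  · split_ifs with hp
    · rw [Finset.sum_eq_single ⟨p, hp⟩ _ (by simp)]
      · simp [Finset.sum_filter]
      · intro k _ hk
        refine Finset.sum_eq_zero fun τ _ => if_neg fun h => hk (Fin.ext h.1)
    · refine Finset.sum_eq_zero fun k _ => Finset.sum_eq_zero fun τ _ => if_neg fun h => ?_
      omega

-- Sorting the shuffles by what comes first turns into Pascal's rule.
open Classical in
lemma card_isShuffle (n p : ℕ) (hp : p ≤ n) :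
    ((Finset.univ : Finset (Perm (Fin n))).filter (IsShuffle p)).card = n.choose p := by
  induction n generalizing p with
  | zero =>
    obtain rfl : p = 0 := by omega
    rw [Finset.filter_true_of_mem]
    · simp
    · exact fun σ _ => ⟨fun k => k.elim0, fun k => k.elim0⟩
  | succ n ih =>
    rw [Finset.card_eq_sum_ones, sum_isShuffle_succ]
    simp only [← Finset.card_eq_sum_ones]
    rcases p with _ | p
    · simp [ih]
    · rcases Nat.lt_or_ge (p + 1) (n + 1) with h | h
      · simp only [Nat.zero_lt_succ, if_true, Nat.add_sub_cancel, dif_pos h]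
        rw [ih p (by omega), ih (p + 1) (by omega), Nat.choose_succ_succ]
      · obtain rfl : p = n := by omega
        simp [ih]

open Classical Word in
/-- The signed sum over the `(p, n - p)`-shuffles in terms of words. -/
lemma sum_isShuffle_ofFn {A G : Type*} [AddCommGroup G] [Module ℂ G] (p : ℕ) (hp : p ≤ n)
    (F : List A → G) (a : Fin n → A) :
    ∑ σ : Perm (Fin n) with IsShuffle p σ,
        ((Perm.sign σ : ℤ) : ℂ) • F (List.ofFn (a ∘ ⇑σ⁻¹))
      = shuffleSum F ((List.ofFn a).take p) ((List.ofFn a).drop p) := by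
  induction n generalizing p F with
  | zero =>
    obtain rfl : p = 0 := by omega
    rw [Finset.filter_true_of_mem]
    · simp
    · exact fun σ _ => ⟨fun k => k.elim0, fun k => k.elim0⟩
  | succ n ih =>
    have hcons : ∀ (k : Fin (n + 1)) (τ : Perm (Fin n)),
        ((Perm.sign (consPerm k τ) : ℤ) : ℂ) • F (List.ofFn (a ∘ ⇑(consPerm k τ)⁻¹))
          = (-1 : ℂ) ^ (k : ℕ) • ((Perm.sign τ : ℤ) : ℂ) •
            F (a k :: List.ofFn (k.removeNth a ∘ ⇑τ⁻¹)) := by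
      intro k τ
      rw [sign_consPerm, comp_consPerm_inv, List.ofFn_cons, smul_smul]
      push_cast
      rfl
    have hsum : ∀ (k : Fin (n + 1)) (r : ℕ), r ≤ n →
        ∑ τ : Perm (Fin n) with IsShuffle r τ,
          ((Perm.sign (consPerm k τ) : ℤ) : ℂ) • F (List.ofFn (a ∘ ⇑(consPerm k τ)⁻¹))
          = (-1 : ℂ) ^ (k : ℕ) • shuffleSum (fun w => F (a k :: w))
            ((List.ofFn (k.removeNth a)).take r) ((List.ofFn (k.removeNth a)).drop r) := by
      intro k r hr
      simp only [hcons, ← Finset.smul_sum]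
      rw [ih r hr (fun w => F (a k :: w))]
    have h0 : List.ofFn a = a 0 :: List.ofFn (Fin.removeNth 0 a) := by
      rw [List.ofFn_succ]; rfl
    rw [sum_isShuffle_succ]
    rcases p with _ | p
    · rw [if_neg (lt_irrefl 0), dif_pos (Nat.succ_pos n), hsum _ 0 (Nat.zero_le n)]
      simp
      rfl
    · rw [if_pos (Nat.succ_pos p), Nat.add_sub_cancel, hsum 0 p (by omega)]
      rcases Nat.lt_or_ge (p + 1) (n + 1) with h | h
      · have h₁ : (List.ofFn (Fin.removeNth 0 a)).drop p
            = a ⟨p + 1, h⟩ :: (List.ofFn (Fin.removeNth ⟨p + 1, h⟩ a)).drop (p + 1) := by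
          rw [List.drop_eq_getElem_cons (by simp; omega)]
          congr 1
          · simp [Fin.tail]
          · refine List.ext_getElem (by simp) fun m _ _ => ?_
            simp only [List.getElem_drop, List.getElem_ofFn, Fin.removeNth]
            congr 1
            rw [Fin.succAbove_of_le_castSucc, Fin.succAbove_of_le_castSucc] <;>
              simp [Fin.le_def]
        have h₂ : (List.ofFn (Fin.removeNth ⟨p + 1, h⟩ a)).take (p + 1)
            = a 0 :: (List.ofFn (Fin.removeNth 0 a)).take p := by
          rw [← List.take_succ_cons, ← h0]
          refine List.ext_getElem (by simp; omega) fun m hm _ => ?_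
          simp only [List.length_take, List.length_ofFn] at hm
          simp only [List.getElem_take, List.getElem_ofFn, Fin.removeNth]
          congr 1
          rw [Fin.succAbove_of_castSucc_lt]
          · rfl
          · simp only [Fin.lt_def, Fin.val_castSucc]; omega
        rw [dif_pos h, hsum ⟨p + 1, h⟩ (p + 1) (by omega), h₂, h0, List.take_succ_cons,
          List.drop_succ_cons, h₁, shuffleSum_cons_cons]
        simp [Nat.min_eq_left (by omega : p ≤ n)]
      -- The second block is empty, so only the initial entry of the first block can come first.
      · obtain rfl : p = n := by omega
        rw [dif_neg (lt_irrefl _), h0]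
        simp [List.take_of_length_le, List.drop_of_length_le]

lemma Word.splitSum_eq_sum {A G : Type*} [AddCommGroup G] (H : List A → List A → G) (w : List A) :
    splitSum H w = ∑ p ∈ Finset.range (w.length + 1), H (w.take p) (w.drop p) := by
  induction w generalizing H with
  | nil => simp [splitSum]
  | cons a w ih =>
    rw [splitSum, ih, List.length_cons, Finset.sum_range_succ' _ (w.length + 1), add_comm]
    simp

end Perm

/-! ## The shuffle element and the Hochschild differential on functions of tuples -/

section Tuples

open Equiv

/-- The common formal shape of the Hochschild boundary and coboundary: `T₁ c` is `T₀` with an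
additional action of `c` on the coefficients. -/
def tupleDifferential {A G : Type*} [Mul A] [AddCommGroup G] [Module ℂ G] {n : ℕ}
    (T₀ : (Fin n → A) → G) (T₁ : A → (Fin n → A) → G) (a : Fin (n + 1) → A) : G :=
  T₁ (a 0) (Fin.tail a)
    + ∑ j : Fin n, (-1 : ℂ) ^ ((j : ℕ) + 1) • T₀ (Fin.contractNth j.castSucc (· * ·) a)
    + (-1 : ℂ) ^ (n + 1) • T₁ (a (Fin.last n)) (Fin.init a)

lemma contractNth_zero_eq_cons {A : Type*} [Mul A] {n : ℕ} (a : Fin (n + 2) → A) :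
    Fin.contractNth (Fin.castSucc 0) (· * ·) a
      = Fin.cons (a 0 * a 1) (Fin.tail (Fin.tail a)) := by
  funext k
  refine Fin.cases ?_ (fun k => ?_) k
  · simp [Fin.contractNth]
  · simp [Fin.contractNth, Fin.tail]

lemma contractNth_succ_eq_cons {A : Type*} [Mul A] {n : ℕ} (j : Fin n) (a : Fin (n + 2) → A) :
    Fin.contractNth j.succ.castSucc (· * ·) a
      = Fin.cons (a 0) (Fin.contractNth j.castSucc (· * ·) (Fin.tail a)) := by
  funext k
  refine Fin.cases ?_ (fun k => ?_) k
  · simp [Fin.contractNth]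
  · simp [Fin.contractNth, Fin.tail]

namespace Word

variable {A G : Type*} [AddCommGroup G] [Module ℂ G]

lemma rightFace_ofFn {n : ℕ} (T : A → List A → G) (a : Fin (n + 1) → A) :
    rightFace T (List.ofFn a)
      = (-1 : ℂ) ^ (n + 1) • T (a (Fin.last n)) (List.ofFn (Fin.init a)) := by
  induction n generalizing T with
  | zero => simp [rightFace, atNil, List.ofFn_succ]
  | succ n ih =>
    have h : List.ofFn a = a 0 :: List.ofFn (Fin.tail a) := List.ofFn_succ
    have h₁ : List.ofFn (Fin.tail a) = a 1 :: List.ofFn (Fin.tail (Fin.tail a)) := List.ofFn_succ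
    have h₂ : List.ofFn (Fin.init a) = a 0 :: List.ofFn (Fin.init (Fin.tail a)) := List.ofFn_succ
    have h₃ : Fin.tail a (Fin.last n) = a (Fin.last (n + 1)) := rfl
    rw [h, rightFace, ih, h₂, h₃, h₁, atNil]
    module

lemma innerFaces_ofFn [Mul A] {n : ℕ} (T : List A → G) (a : Fin (n + 1) → A) :
    innerFaces T (List.ofFn a) = ∑ j : Fin n, (-1 : ℂ) ^ ((j : ℕ) + 1) •
      T (List.ofFn (Fin.contractNth j.castSucc (· * ·) a)) := by
  induction n generalizing T with
  | zero => simp [innerFaces, leftFace, List.ofFn_succ]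
  | succ n ih =>
    have h : List.ofFn a = a 0 :: List.ofFn (Fin.tail a) := List.ofFn_succ
    have h₁ : List.ofFn (Fin.tail a) = a 1 :: List.ofFn (Fin.tail (Fin.tail a)) := List.ofFn_succ
    rw [h, innerFaces, ih, h₁, leftFace, Fin.sum_univ_succ, contractNth_zero_eq_cons,
      List.ofFn_cons, sub_eq_add_neg, ← Finset.sum_neg_distrib]
    simp only [contractNth_succ_eq_cons, List.ofFn_cons, Fin.val_succ, Fin.val_zero]
    congr 1
    · simp
    · exact Finset.sum_congr rfl fun j _ => by module

lemma barDifferential_ofFn [Mul A] {n : ℕ} (T₀ : List A → G) (T₁ : A → List A → G)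
    (a : Fin (n + 1) → A) :
    barDifferential T₀ T₁ (List.ofFn a)
      = tupleDifferential (fun b => T₀ (List.ofFn b)) (fun c b => T₁ c (List.ofFn b)) a := by
  rw [barDifferential, rightFace_ofFn, innerFaces_ofFn, List.ofFn_succ, leftFace]
  rfl

end Word

/-- The right action of the group algebra on functions of tuples, dual to the action of the
symmetric group by moving the `k`-th entry to the place `σ k`. -/
def permOp (A G : Type*) [AddCommGroup G] [Module ℂ G] (n : ℕ) :
    MonoidAlgebra ℂ (Perm (Fin n)) →ₗ[ℂ] Module.End ℂ ((Fin n → A) → G) :=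
  (MulOpposite.opLinearEquiv ℂ).symm.toLinearMap ∘ₗ
    (MonoidAlgebra.lift ℂ (Module.End ℂ ((Fin n → A) → G))ᵐᵒᵖ (Perm (Fin n))
      { toFun := fun σ => MulOpposite.op (LinearMap.funLeft ℂ G fun a => a ∘ ⇑σ⁻¹)
        map_one' := rfl
        map_mul' := fun σ τ => by
          rw [← MulOpposite.op_mul, mul_inv_rev]
          rfl }).toLinearMap

variable {A G : Type*} [AddCommGroup G] [Module ℂ G] {n : ℕ}

lemma permOp_single (σ : Perm (Fin n)) (c : ℂ) (F : (Fin n → A) → G) (a : Fin n → A) :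
    permOp A G n (MonoidAlgebra.single σ c) F a = c • F (a ∘ ⇑σ⁻¹) := by
  simp [permOp, LinearMap.funLeft]

lemma permOp_one (F : (Fin n → A) → G) : permOp A G n 1 F = F := by
  simp [permOp]

lemma permOp_mul (x y : MonoidAlgebra ℂ (Perm (Fin n))) (F : (Fin n → A) → G) :
    permOp A G n (x * y) F = permOp A G n y (permOp A G n x F) := by
  simp [permOp]

lemma permOp_apply (x : MonoidAlgebra ℂ (Perm (Fin n))) (F : (Fin n → A) → G) (a : Fin n → A) :
    permOp A G n x F a = ∑ σ, x.coeff σ • F (a ∘ ⇑σ⁻¹) := by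
  classical
  induction x using MonoidAlgebra.induction_linear with
  | zero => simp
  | add x y hx hy => simp [hx, hy, add_smul, Finset.sum_add_distrib]
  | single σ c => simp [permOp_single, Finsupp.single_apply, ite_smul]

/-- The group algebra permutes arguments, while `f` acts on values. This carries identities for
functions of tuples over to chains and cochains. -/
lemma map_permOp {G' : Type*} [AddCommGroup G'] [Module ℂ G'] (f : G →ₗ[ℂ] G')
    (x : MonoidAlgebra ℂ (Perm (Fin n))) (F : (Fin n → A) → G) (a : Fin n → A) :
    f (permOp A G n x F a) = permOp A G' n x (fun b => f (F b)) a := by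
  simp [permOp_apply]

open Word in
-- The cuts at the two ends, absent from `s_n`, each contribute `F` once. They are distinct cuts
-- only because `0 < n`.
lemma permOp_shuffleElement_ofFn (hn : 0 < n) (F : List A → G) (a : Fin n → A) :
    permOp A G n (shuffleElement n) (fun b => F (List.ofFn b)) a
      = splitSum (shuffleSum F) (List.ofFn a) - (2 : ℂ) • F (List.ofFn a) := by
  classical
  have h : permOp A G n (shuffleElement n) (fun b => F (List.ofFn b)) a
      = ∑ p ∈ Finset.Ioo 0 n,
        shuffleSum F ((List.ofFn a).take p) ((List.ofFn a).drop p) := by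
    simp only [shuffleElement, map_sum, LinearMap.sum_apply, Finset.sum_apply, permOp_single]
    refine Finset.sum_congr rfl fun p hp => ?_
    rw [← sum_isShuffle_ofFn p (Finset.mem_Ioo.1 hp).2.le]
  obtain ⟨n, rfl⟩ := Nat.exists_eq_succ_of_ne_zero hn.ne'
  have h' : Finset.Ioo 0 (n + 1) = (Finset.range n).image (· + 1) := by
    ext p
    simp only [Finset.mem_Ioo, Finset.mem_image, Finset.mem_range]
    exact ⟨fun hp => ⟨p - 1, by omega⟩, by rintro ⟨q, hq, rfl⟩; omega⟩
  rw [h, h', Finset.sum_image (by simp), splitSum_eq_sum, List.length_ofFn,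
    Finset.sum_range_succ, Finset.sum_range_succ',
    List.take_of_length_le (i := n.succ) (by simp), List.drop_of_length_le (i := n.succ) (by simp)]
  simp only [List.take_zero, List.drop_zero, shuffleSum_nil_left, shuffleSum_nil_right]
  module

lemma shuffleElement_of_le_one (hn : n ≤ 1) : shuffleElement n = 0 := by
  have h : Finset.Ioo 0 n = ∅ := by ext; simp; omega
  simp [shuffleElement, h]

omit [Module ℂ G] in
-- Lets every identity about tuples of fixed length be proved by recursion on words.
lemma exists_eq_comp_ofFn (T : (Fin n → A) → G) : ∃ F : List A → G, T = fun b => F (List.ofFn b) :=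
  ⟨Function.extend List.ofFn T 0, funext fun b => (List.ofFn_injective.extend_apply T 0 b).symm⟩

/-- The shuffle elements commute with the Hochschild differential. -/
theorem permOp_shuffleElement_tupleDifferential [CommMagma A] (T₀ : (Fin n → A) → G)
    (T₁ : A → (Fin n → A) → G) :
    permOp A G (n + 1) (shuffleElement (n + 1)) (tupleDifferential T₀ T₁)
      = tupleDifferential (permOp A G n (shuffleElement n) T₀)
        (fun c => permOp A G n (shuffleElement n) (T₁ c)) := by
  -- In degree zero the formula with cuts fails, but both shuffle elements involved are zero.
  rcases Nat.eq_zero_or_pos n with rfl | hn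
  · funext a
    simp [shuffleElement_of_le_one, tupleDifferential]
  obtain ⟨F₀, rfl⟩ := exists_eq_comp_ofFn T₀
  choose F₁ hF₁ using fun c => exists_eq_comp_ofFn (T₁ c)
  obtain rfl : T₁ = fun c b => F₁ c (List.ofFn b) := funext hF₁
  have hD : tupleDifferential (fun b => F₀ (List.ofFn b)) (fun c b => F₁ c (List.ofFn b))
      = fun a : Fin (n + 1) → A => Word.barDifferential F₀ F₁ (List.ofFn a) :=
    funext fun a => (Word.barDifferential_ofFn F₀ F₁ a).symm
  funext a
  rw [hD, permOp_shuffleElement_ofFn n.succ_pos, Word.splitSum_shuffleSum_barDifferential,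
    Word.barDifferential_ofFn, Word.barDifferential_ofFn]
  simp only [tupleDifferential, permOp_shuffleElement_ofFn hn, smul_sub, Finset.sum_sub_distrib,
    smul_add, Finset.smul_sum]
  rw [sub_eq_iff_eq_add]
  have h : ∀ j : Fin n, (-1 : ℂ) ^ ((j : ℕ) + 1) • (2 : ℂ) •
      F₀ (List.ofFn (Fin.contractNth j.castSucc (· * ·) a)) = (2 : ℂ) • (-1 : ℂ) ^ ((j : ℕ) + 1) •
      F₀ (List.ofFn (Fin.contractNth j.castSucc (· * ·) a)) := fun j => smul_comm _ _ _
  simp only [h]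
  module

lemma tupleDifferential_add [Mul A] (T₀ S₀ : (Fin n → A) → G) (T₁ S₁ : A → (Fin n → A) → G) :
    tupleDifferential (T₀ + S₀) (fun c => T₁ c + S₁ c)
      = tupleDifferential T₀ T₁ + tupleDifferential S₀ S₁ := by
  funext a
  simp only [tupleDifferential, Pi.add_apply, smul_add, Finset.sum_add_distrib]
  abel

lemma tupleDifferential_smul [Mul A] (c : ℂ) (T₀ : (Fin n → A) → G) (T₁ : A → (Fin n → A) → G) :
    tupleDifferential (c • T₀) (fun b => c • T₁ b) = c • tupleDifferential T₀ T₁ := by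
  funext a
  simp only [tupleDifferential, Pi.smul_apply, smul_add, Finset.smul_sum, smul_comm c]

/-- Polynomials in the shuffle elements commute with the Hochschild differential. -/
theorem permOp_aeval_tupleDifferential [CommMagma A] (P : Polynomial ℂ) (T₀ : (Fin n → A) → G)
    (T₁ : A → (Fin n → A) → G) :
    permOp A G (n + 1) (Polynomial.aeval (shuffleElement (n + 1)) P) (tupleDifferential T₀ T₁)
      = tupleDifferential (permOp A G n (Polynomial.aeval (shuffleElement n) P) T₀)
        (fun c => permOp A G n (Polynomial.aeval (shuffleElement n) P) (T₁ c)) := by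
  induction P using Polynomial.induction_on with
  | C c =>
    simp only [Polynomial.aeval_C, Algebra.algebraMap_eq_smul_one, map_smul, LinearMap.smul_apply,
      permOp_one, tupleDifferential_smul]
  | add P Q hP hQ =>
    simp only [map_add, LinearMap.add_apply, hP, hQ, tupleDifferential_add]
  | monomial k c h =>
    rw [pow_succ, ← mul_assoc]
    simp only [map_mul _ (_ * _) Polynomial.X, Polynomial.aeval_X, permOp_mul, h,
      permOp_shuffleElement_tupleDifferential]

end Tuples

/-! ## The minimal polynomial of the shuffle element -/

section Annihilation

open Equiv

/-- The antisymmetrizer `∑ sgn(σ) σ`. -/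
def antisymmetrizer (n : ℕ) : MonoidAlgebra ℂ (Perm (Fin n)) :=
  ∑ σ : Perm (Fin n), MonoidAlgebra.single σ ((Perm.sign σ : ℤ) : ℂ)

lemma single_sign_mul_antisymmetrizer {n : ℕ} (τ : Perm (Fin n)) :
    MonoidAlgebra.single τ ((Perm.sign τ : ℤ) : ℂ) * antisymmetrizer n = antisymmetrizer n := by
  rw [antisymmetrizer, Finset.mul_sum]
  refine Fintype.sum_equiv (Equiv.mulLeft τ) _ _ fun σ => ?_
  rw [MonoidAlgebra.single_mul_single, Equiv.coe_mulLeft, Perm.sign_mul]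
  push_cast
  rfl

/-- Each signed shuffle fixes the antisymmetrizer, so the eigenvalue is the number of shuffles, the
sum of the binomial coefficients without the two extreme ones. -/
lemma shuffleElement_mul_antisymmetrizer {n : ℕ} (hn : 0 < n) :
    shuffleElement n * antisymmetrizer n = ((2 : ℂ) ^ n - 2) • antisymmetrizer n := by
  classical
  have h : ((∑ p ∈ Finset.Ioo 0 n, n.choose p : ℕ) : ℂ) = 2 ^ n - 2 := by
    obtain ⟨n, rfl⟩ := Nat.exists_eq_succ_of_ne_zero hn.ne'
    have h' : Finset.Ioo 0 (n + 1) = (Finset.range n).image (· + 1) := by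
      ext p
      simp only [Finset.mem_Ioo, Finset.mem_image, Finset.mem_range]
      exact ⟨fun hp => ⟨p - 1, by omega⟩, by rintro ⟨q, hq, rfl⟩; omega⟩
    have h₁ := Nat.sum_range_choose (n + 1)
    rw [Finset.sum_range_succ, Finset.sum_range_succ', Nat.choose_self, Nat.choose_zero_right] at h₁
    rw [Nat.succ_eq_add_one, h', Finset.sum_image (by simp), eq_sub_iff_add_eq]
    exact_mod_cast h₁
  rw [← h, shuffleElement, Finset.sum_mul, Nat.cast_sum, Finset.sum_smul]
  refine Finset.sum_congr rfl fun p hp => ?_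
  rw [Finset.sum_mul, Finset.sum_congr rfl fun σ _ => single_sign_mul_antisymmetrizer σ,
    Finset.sum_const, ← card_isShuffle n p (Finset.mem_Ioo.1 hp).2.le, Nat.cast_smul_eq_nsmul]

/-! ### Free commutative monoids as test objects for the boundary -/

/-- The free commutative monoid on `n` generators, written multiplicatively. -/
abbrev FreeMon (n : ℕ) : Type := Multiplicative (Multiset (Fin n))

/-- The tuple of the generators, in the order given by `σ`. -/
def genTuple {n : ℕ} (σ : Perm (Fin n)) (k : Fin n) : FreeMon n := Multiplicative.ofAdd {σ k}

/-- A merged tuple of generators remembers where the merge happened, as its only entry of degree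
two, and the order of all generators except that of the merged pair. -/
lemma contractNth_genTuple_eq_iff {n : ℕ} (i j : Fin n) (ρ σ : Perm (Fin (n + 1))) :
    Fin.contractNth i.castSucc (· * ·) (genTuple ρ) = Fin.contractNth j.castSucc (· * ·) (genTuple σ)
      ↔ i = j ∧ (ρ = σ ∨ ρ = σ * swap j.castSucc j.succ) := by
  have hself : ∀ π : Perm (Fin (n + 1)), Fin.contractNth j.castSucc (· * ·) (genTuple π) j
      = Multiplicative.ofAdd {π j.castSucc, π j.succ} := fun π => by
    rw [Fin.contractNth_apply_of_eq _ _ _ _ rfl]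
    rfl
  have hne : ∀ (π : Perm (Fin (n + 1))) (i k : Fin n), i ≠ k →
      Fin.contractNth i.castSucc (· * ·) (genTuple π) k
        = Multiplicative.ofAdd {π (i.castSucc.succAbove k)} := fun π i k hik => by
    rw [Fin.contractNth_apply_of_ne _ _ _ _ (by simpa [Fin.ext_iff] using hik)]
    rfl
  constructor
  · intro h
    obtain rfl : i = j := by
      by_contra hij
      have h' := congrFun h j
      rw [hself, hne _ _ _ hij] at h'
      -- The entry at `j` has degree one on one side and two on the other.
      simpa using congrArg (fun s : FreeMon (n + 1) => s.toAdd.card) h'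
    refine ⟨rfl, ?_⟩
    have hρσ : ∀ m : Fin (n + 1), m ≠ i.castSucc → m ≠ i.succ → ρ m = σ m := by
      intro m hm hm'
      obtain ⟨k, rfl⟩ := Fin.exists_succAbove_eq hm
      have hik : i ≠ k := by
        rintro rfl
        exact hm' (Fin.succAbove_castSucc_self i)
      have h' := congrFun h k
      rw [hne _ _ _ hik, hne _ _ _ hik] at h'
      simpa using h'
    have hi : ({ρ i.castSucc, ρ i.succ} : Multiset (Fin (n + 1))) = {σ i.castSucc, σ i.succ} := by
      have h' := congrFun h i
      rw [hself, hself] at h'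
      exact h'
    have hmem : ρ i.castSucc ∈ ({σ i.castSucc, σ i.succ} : Multiset (Fin (n + 1))) := by
      rw [← hi]; simp
    simp only [Multiset.insert_eq_cons, Multiset.mem_cons, Multiset.mem_singleton] at hmem
    rcases hmem with h₁ | h₁
    · have h₂ : ρ i.succ = σ i.succ := by
        rw [h₁] at hi
        simpa using hi
      refine Or.inl (Equiv.ext fun m => ?_)
      by_cases hm : m = i.castSucc
      · rw [hm, h₁]
      by_cases hm' : m = i.succ
      · rw [hm', h₂]
      exact hρσ m hm hm'
    · have h₂ : ρ i.succ = σ i.castSucc := by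
        rw [h₁, Multiset.pair_comm] at hi
        simpa using hi
      refine Or.inr (Equiv.ext fun m => ?_)
      by_cases hm : m = i.castSucc
      · rw [hm, h₁, Perm.mul_apply, swap_apply_left]
      by_cases hm' : m = i.succ
      · rw [hm', h₂, Perm.mul_apply, swap_apply_right]
      rw [hρσ m hm hm', Perm.mul_apply, swap_apply_of_ne_of_ne hm hm']
  · rintro ⟨rfl, rfl | rfl⟩
    · rfl
    · funext k
      by_cases hik : i = k
      · subst hik
        rw [hself, hself, Perm.mul_apply, Perm.mul_apply, swap_apply_left, swap_apply_right,
          Multiset.pair_comm]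
      · rw [hne _ _ _ hik, hne _ _ _ hik, Perm.mul_apply, swap_apply_of_ne_of_ne]
        · exact Fin.succAbove_ne _ _
        · rw [← Fin.succAbove_castSucc_self i]
          exact fun h => hik (Fin.succAbove_right_injective h).symm

/-- An element of the group algebra whose universal boundary vanishes is a multiple of the
antisymmetrizer. -/
lemma eq_smul_antisymmetrizer {n : ℕ} (x : MonoidAlgebra ℂ (Perm (Fin (n + 1))))
    (hx : ∀ T : (Fin n → FreeMon (n + 1)) → ℂ,
      permOp (FreeMon (n + 1)) ℂ (n + 1) x (tupleDifferential T 0) = 0) :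
    ∃ c : ℂ, x = c • antisymmetrizer (n + 1) := by
  classical
  have hswap : ∀ (j : Fin n) (σ : Perm (Fin (n + 1))),
      x.coeff (swap j.castSucc j.succ * σ) = -x.coeff σ := by
    intro j σ
    have hσ : σ ≠ swap j.castSucc j.succ * σ := fun h => by
      have h' : swap j.castSucc j.succ = 1 := by simpa using h.symm
      exact Fin.castSucc_lt_succ.ne (swap_eq_one_iff.1 h')
    -- Test on the indicator of a single merged tuple, evaluated at the generators in standard
    -- order: only `σ` and its product with the `j`-th adjacent transposition contribute, so their
    -- coefficients add up to zero.
    have h := congrFun (hx fun w =>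
      if w = Fin.contractNth j.castSucc (· * ·) (genTuple σ⁻¹) then 1 else 0) (genTuple 1)
    have hcomp : ∀ ρ : Perm (Fin (n + 1)), genTuple 1 ∘ ⇑ρ = genTuple ρ := fun _ => rfl
    have hinv : ∀ ρ : Perm (Fin (n + 1)),
        (ρ⁻¹ = σ⁻¹ ∨ ρ⁻¹ = σ⁻¹ * swap j.castSucc j.succ)
          ↔ (ρ = σ ∨ ρ = swap j.castSucc j.succ * σ) := fun ρ => by
      rw [inv_inj, inv_eq_iff_eq_inv, mul_inv_rev, inv_inv, swap_inv]
    simp only [permOp_apply, tupleDifferential, hcomp, contractNth_genTuple_eq_iff, hinv,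
      Pi.zero_apply, zero_add, add_zero, ite_and, mul_ite, smul_eq_mul, mul_one,
      mul_zero, Finset.sum_ite_eq', Finset.mem_univ, if_true] at h
    rw [← Finset.sum_filter, Finset.filter_or, Finset.sum_union] at h
    · simp only [Finset.filter_eq', Finset.mem_univ, if_true, Finset.sum_singleton] at h
      rw [← add_mul] at h
      have := (mul_eq_zero.1 h).resolve_right (pow_ne_zero _ (by norm_num))
      linear_combination this
    · simp [Finset.filter_eq', hσ]
  -- Adjacent transpositions generate the symmetric group, so the coefficient at `1` determines all
  -- others up to sign.
  have hsign : ∀ σ : Perm (Fin (n + 1)), x.coeff σ = x.coeff 1 * ((Perm.sign σ : ℤ) : ℂ) := by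
    intro σ
    have hσ : σ ∈ Submonoid.closure (Set.range fun i : Fin n ↦ swap i.castSucc i.succ) := by
      rw [Perm.mclosure_swap_castSucc_succ]; trivial
    induction hσ using Submonoid.closure_induction_left with
    | one => simp
    | mul_left τ hτ σ _ ih =>
      obtain ⟨j, rfl⟩ := hτ
      rw [hswap, ih, Perm.sign_mul, Perm.sign_swap Fin.castSucc_lt_succ.ne]
      simp
  refine ⟨x.coeff 1, ?_⟩
  ext σ
  simp [antisymmetrizer, hsign σ, Finsupp.single_apply]

/-- The shuffle element `s_n` is annihilated by `∏ (X - (2^j - 2))`, where `1 ≤ j ≤ n`. -/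
theorem aeval_shuffleElement_nodal {n : ℕ} (hn : 0 < n) :
    Polynomial.aeval (shuffleElement n)
      (Lagrange.nodal (Finset.Icc 1 n) fun j : ℕ => (2 : ℂ) ^ j - 2) = 0 := by
  induction n, hn using Nat.le_induction with
  | base => simp [Lagrange.nodal, shuffleElement_of_le_one]
  | succ n hn ih =>
    -- The product for `n`, evaluated at `s_{n+1}`, can be moved inside the boundary, where it is
    -- evaluated at `s_n` and vanishes by induction. The new factor, for `j = n + 1`, then kills the
    -- antisymmetrizer.
    obtain ⟨c, hc⟩ := eq_smul_antisymmetrizer (Polynomial.aeval (shuffleElement (n + 1))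
      (Lagrange.nodal (Finset.Icc 1 n) fun j : ℕ => (2 : ℂ) ^ j - 2)) fun T => by
        rw [permOp_aeval_tupleDifferential, ih]
        funext a
        simp [tupleDifferential]
    rw [← Finset.insert_Icc_right_eq_Icc_add_one (by omega),
      Lagrange.nodal_insert_eq_nodal (by simp), map_mul, hc, map_sub, Polynomial.aeval_X,
      Polynomial.aeval_C, mul_smul_comm, sub_mul, shuffleElement_mul_antisymmetrizer (Nat.add_one_pos n),
      Algebra.algebraMap_eq_smul_one, smul_one_mul, sub_self, smul_zero]

lemma two_pow_sub_two_injective : Function.Injective fun j : ℕ => (2 : ℂ) ^ j - 2 := fun j k h => by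
  have h' : ((2 ^ j : ℕ) : ℂ) = (2 ^ k : ℕ) := by
    push_cast
    simpa using h
  exact Nat.pow_right_injective le_rfl (Nat.cast_injective h')

lemma commute_shuffleElement_aeval (n : ℕ) (P : Polynomial ℂ) :
    Commute (shuffleElement n) (Polynomial.aeval (shuffleElement n) P) := by
  simpa using (Commute.all Polynomial.X P).map (Polynomial.aeval (R := ℂ) (shuffleElement n))

/-- The first idempotent is annihilated by the shuffle element. -/
theorem shuffleElement_mul_bgs (n : ℕ) : shuffleElement n * bgs n 1 = 0 := by
  rcases Nat.eq_zero_or_pos n with rfl | hn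
  · rw [shuffleElement_of_le_one (by omega), zero_mul]
  -- The node for `j = 1` is `0`: up to a constant the basis polynomial is the nodal polynomial
  -- without its factor `X`, and multiplication by `s_n` restores that factor.
  have h : ∃ c : ℂ, Lagrange.basis (Finset.Icc 1 n) (fun j : ℕ => (2 : ℂ) ^ j - 2) 1
      = Polynomial.C c * Lagrange.nodal ((Finset.Icc 1 n).erase 1) fun j : ℕ => (2 : ℂ) ^ j - 2 := by
    refine ⟨∏ j ∈ (Finset.Icc 1 n).erase 1, ((2 : ℂ) ^ 1 - 2 - (2 ^ j - 2))⁻¹, ?_⟩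
    rw [Lagrange.basis, Lagrange.nodal, map_prod, ← Finset.prod_mul_distrib]
    rfl
  obtain ⟨c, hc⟩ := h
  have h₀ := aeval_shuffleElement_nodal hn
  rw [Lagrange.nodal_eq_mul_nodal_erase (Finset.mem_Icc.2 ⟨le_rfl, hn⟩), pow_one, sub_self,
    Polynomial.C_0, sub_zero, map_mul, Polynomial.aeval_X] at h₀
  rw [bgs, hc, map_mul, Polynomial.aeval_C, Algebra.algebraMap_eq_smul_one, smul_one_mul,
    mul_smul_comm, h₀, smul_zero]

/-- The first idempotent is `1` modulo the shuffle element. -/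
lemma exists_bgs_eq_one_add (n : ℕ) :
    ∃ Q : MonoidAlgebra ℂ (Perm (Fin n)), bgs n 1 = 1 + shuffleElement n * Q ∧
      Commute (shuffleElement n) Q := by
  -- The value at the node `0` is the constant term; for `n = 0` the basis polynomial is an empty
  -- product.
  have h : (Lagrange.basis (Finset.Icc 1 n) (fun j : ℕ => (2 : ℂ) ^ j - 2) 1).eval 0 = 1 := by
    rcases Nat.eq_zero_or_pos n with rfl | hn
    · simp
    · have h₀ := Lagrange.eval_basis_self (v := fun j : ℕ => (2 : ℂ) ^ j - 2)
        two_pow_sub_two_injective.injOn (Finset.mem_Icc.2 ⟨le_rfl, hn⟩ : 1 ∈ Finset.Icc 1 n)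
      simpa using h₀
  obtain ⟨Q, hQ⟩ : Polynomial.X ∣
      Lagrange.basis (Finset.Icc 1 n) (fun j : ℕ => (2 : ℂ) ^ j - 2) 1 - 1 := by
    rw [Polynomial.X_dvd_iff, Polynomial.coeff_zero_eq_eval_zero, Polynomial.eval_sub, h,
      Polynomial.eval_one, sub_self]
  refine ⟨Polynomial.aeval (shuffleElement n) Q, ?_, commute_shuffleElement_aeval n Q⟩
  rw [bgs, eq_add_of_sub_eq' hQ, map_add, map_mul, map_one, Polynomial.aeval_X]

lemma bgs_mul_shuffleElement (n : ℕ) : bgs n 1 * shuffleElement n = 0 := by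
  rw [← shuffleElement_mul_bgs n]
  exact (commute_shuffleElement_aeval n _).symm

end Annihilation

/-! ## The Hochschild differential squares to zero -/

namespace Word

variable {A G : Type*} [AddCommGroup G] [Module ℂ G]

omit [Module ℂ G] in
lemma leftFace_cons (T : A → List A → G) (a : A) (w : List A) : leftFace T (a :: w) = T a w := rfl

omit [Module ℂ G] in
lemma leftFace_nil (T : A → List A → G) : leftFace T [] = 0 := rfl

omit [Module ℂ G] in
lemma leftFace_zero (w : List A) : leftFace (fun _ _ => (0 : G)) w = 0 := by
  cases w <;> rfl

omit [Module ℂ G] in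
lemma atNil_zero (w : List A) : atNil (0 : G) w = 0 := by
  cases w <;> rfl

omit [Module ℂ G] in
-- Removing the first letter after merging it with the second cancels removing both in turn. The
-- other merges commute with the removal up to sign, since it shifts their positions by one.
lemma leftFace_leftFace_add_innerFaces [Mul A] (T : A → List A → G) (w : List A) :
    leftFace (fun c => leftFace fun d => T (c * d)) w + leftFace (fun c => innerFaces (T c)) w
      + innerFaces (leftFace T) w = 0 := by
  cases w with
  | nil => simp [leftFace, innerFaces]
  | cons a w =>
    simp only [leftFace_cons, innerFaces]
    abel

/-- The merges involving the first letter `a` cancel as in `leftFace_leftFace_add_innerFaces`, with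
`a` multiplied into the coefficients; associativity identifies the two triple products. -/
lemma innerFaces_innerFaces [Semigroup A] (T : List A → G) (w : List A) :
    innerFaces (innerFaces T) w = 0 := by
  induction w generalizing T with
  | nil => rfl
  | cons a w ih =>
    have h := leftFace_leftFace_add_innerFaces (fun c w' => T (a * c :: w')) w
    simp only [← mul_assoc] at h
    have hl : ∀ (K : A → List A → G), leftFace (fun c w => -K c w) w = -leftFace K w := fun K => by
      simpa using leftFace_smul (-1) K w
    have hi : ∀ (K : List A → G), innerFaces (fun w => -K w) w = -innerFaces K w := fun K => by
      simpa using innerFaces_smul (-1) K w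
    simp only [innerFaces, sub_eq_add_neg, leftFace_add, innerFaces_add, hl, hi, ih]
    linear_combination (norm := module) h

lemma rightFace_zero (w : List A) : rightFace (fun _ _ => (0 : G)) w = 0 := by
  simpa using rightFace_smul 0 (fun (_ : A) _ => (0 : G)) w

lemma rightFace_neg (T : A → List A → G) (w : List A) :
    rightFace (fun c w => -T c w) w = -rightFace T w := by
  simpa using rightFace_smul (-1) T w

omit [Module ℂ G] in
lemma rightFace_leftFace (K : A → A → List A → G) (w : List A) :
    rightFace (fun c => leftFace (K c)) w + leftFace (fun d => rightFace fun c => K c d) w = 0 := by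
  cases w with
  | nil => simp [leftFace, rightFace]
  | cons a w => simp [leftFace_cons, leftFace_nil, atNil_zero, rightFace]

/-- Only one-letter words matter here, and on these both faces remove the same letter, with opposite
signs. -/
lemma rightFace_atNil (g : A → G) (w : List A) :
    rightFace (fun c => atNil (g c)) w = -leftFace (fun c => atNil (g c)) w := by
  cases w <;> simp [leftFace, rightFace, atNil, rightFace_zero]

lemma innerFaces_zero [Mul A] (w : List A) : innerFaces (fun _ => (0 : G)) w = 0 := by
  simpa using innerFaces_smul 0 (fun (_ : List A) => (0 : G)) w

lemma innerFaces_atNil [Mul A] (g : G) (w : List A) : innerFaces (atNil g) w = 0 := by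
  cases w with
  | nil => rfl
  | cons a w =>
    have h : ∀ (c : A) (w : List A), atNil g (c :: w) = 0 := fun _ _ => rfl
    simp only [innerFaces, h, leftFace_zero, innerFaces_zero, neg_zero, sub_zero]

lemma rightFace_rightFace_add_innerFaces [CommMagma A] (T : A → List A → G) (w : List A) :
    rightFace (fun c => rightFace fun b => T (b * c)) w + rightFace (fun c => innerFaces (T c)) w
      + innerFaces (rightFace T) w = 0 := by
  induction w generalizing T with
  | nil => simp [rightFace, innerFaces]
  | cons a w ih =>
    have h := ih (fun c w' => T c (a :: w'))
    -- Corner terms of the recursion: `h₁` merges `a` with its neighbour and removes the last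
    -- letter, `h₂` is the case where these are the only two letters, and `h₃` holds because a merge
    -- never leaves the empty word.
    have h₁ := rightFace_leftFace (fun c d w' => T c (a * d :: w')) w
    have h₂ := rightFace_atNil (fun c => T (a * c) []) w
    have h₃ := innerFaces_atNil (T a []) w
    have hl : ∀ (K : A → List A → G), leftFace (fun c w => -K c w) w = -leftFace K w := fun K => by
      simpa using leftFace_smul (-1) K w
    have hi : ∀ (K : List A → G), innerFaces (fun w => -K w) w = -innerFaces K w := fun K => by
      simpa using innerFaces_smul (-1) K w
    simp only [rightFace, innerFaces, sub_eq_add_neg, leftFace_add, innerFaces_add,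
      rightFace_add, rightFace_neg, hl, hi, atNil_zero]
    linear_combination (norm := module) h + h₁ + h₂ + h₃

/-- The bar differential squares to zero. -/
theorem barDifferential_barDifferential [CommSemigroup A] (T₀ : List A → G)
    (T₁ : A → List A → G) (w : List A) :
    barDifferential (barDifferential T₀ T₁)
      (fun c => barDifferential (T₁ c) fun b => T₁ (b * c)) w = 0 := by
  have h₁ := leftFace_leftFace_add_innerFaces T₁ w
  have h₂ := innerFaces_innerFaces T₀ w
  have h₃ := rightFace_leftFace (fun c b => T₁ (b * c)) w
  have h₄ := rightFace_rightFace_add_innerFaces T₁ w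
  have h : ∀ (S₀ : List A → G) (S₁ : A → List A → G), barDifferential S₀ S₁
      = fun w => leftFace S₁ w + innerFaces S₀ w + rightFace S₁ w := fun _ _ => rfl
  simp only [h, leftFace_add, innerFaces_add, rightFace_add]
  -- Repeated left faces produce the product of the removed letters in the order opposite to the one
  -- prescribed for the coefficients, so commutativity is needed.
  simp only [mul_comm] at h₁ h₂ h₃ h₄ ⊢
  linear_combination (norm := module) h₁ + h₂ + h₃ + h₄

end Word

theorem tupleDifferential_tupleDifferential {A G : Type*} [CommSemigroup A] [AddCommGroup G]
    [Module ℂ G] {n : ℕ} (T₀ : (Fin n → A) → G) (T₁ : A → (Fin n → A) → G)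
    (a : Fin (n + 2) → A) :
    tupleDifferential (tupleDifferential T₀ T₁)
      (fun c => tupleDifferential (T₁ c) fun b => T₁ (b * c)) a = 0 := by
  obtain ⟨F₀, rfl⟩ := exists_eq_comp_ofFn T₀
  choose F₁ hF₁ using fun c => exists_eq_comp_ofFn (T₁ c)
  obtain rfl : T₁ = fun c b => F₁ c (List.ofFn b) := funext hF₁
  have h : ∀ (T₀ : List A → G) (T₁ : A → List A → G),
      tupleDifferential (fun b : Fin n → A => T₀ (List.ofFn b)) (fun c b => T₁ c (List.ofFn b))
        = fun b : Fin (n + 1) → A => Word.barDifferential T₀ T₁ (List.ofFn b) := fun T₀ T₁ =>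
    funext fun b => (Word.barDifferential_ofFn T₀ T₁ b).symm
  simp only [h]
  rw [← Word.barDifferential_ofFn, Word.barDifferential_barDifferential]

lemma map_tupleDifferential {A G G' : Type*} [Mul A] [AddCommGroup G] [Module ℂ G]
    [AddCommGroup G'] [Module ℂ G'] (f : G →ₗ[ℂ] G') {n : ℕ} (T₀ : (Fin n → A) → G)
    (T₁ : A → (Fin n → A) → G) (a : Fin (n + 1) → A) :
    f (tupleDifferential T₀ T₁ a)
      = tupleDifferential (fun b => f (T₀ b)) (fun c b => f (T₁ c b)) a := by
  simp [tupleDifferential]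

open UniformSpace

/-! ## The actions on chains and cochains -/

section Actions

variable {A : Type*} [NonUnitalNormedCommRing A] [NormedSpace ℂ A]
  {M : Type*} [NormedAddCommGroup M] [NormedSpace ℂ M]

lemma algAction_pure {n : ℕ} (x : MonoidAlgebra ℂ (Equiv.Perm (Fin n))) (a : Fin n → A) :
    algAction A n x (tpure a) = permOp A (TPow A n) n x tpure a := by
  induction x using MonoidAlgebra.induction_linear with
  | zero => simp
  | add x y hx hy => simp [hx, hy]
  | single σ c =>
    rw [permOp_single, algAction, MonoidAlgebra.lift_single, smul_apply,
      permAction_pure]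

/-- The elementary chain `x ⊗ a_1 ⊗ ⋯ ⊗ a_n`. -/
def pureChain {n : ℕ} (x : M) (a : Fin n → A) : Chain A M n :=
  (ProjTensor.tmul x (tpure a) : PreChain A M n)

/-- Elementary chains span a dense subspace, so identities of bounded operators on chains reduce to
identities for functions of tuples. -/
lemma chain_ext {n : ℕ} {G : Type*} [NormedAddCommGroup G] [NormedSpace ℂ G]
    {f g : Chain A M n →L[ℂ] G}
    (h : ∀ (x : M) (a : Fin n → A), f (pureChain x a) = g (pureChain x a)) : f = g := by
  ext c
  induction c using Completion.induction_on with
  | hp => exact isClosed_eq (by fun_prop) (by fun_prop)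
  | ih t =>
    have h' : f ∘L Completion.toComplL = g ∘L Completion.toComplL := preChain_ext h
    exact congrArg (fun u : PreChain A M n →L[ℂ] G => u t) h'

/-- The linear map `t ↦ x ⊗ t`. -/
def chainMk (n : ℕ) (x : M) : TPow A n →L[ℂ] Chain A M n :=
  Completion.toComplL ∘L ProjTensor.mk M (TPow A n) x

lemma chainAction_pureChain {n : ℕ} (e : MonoidAlgebra ℂ (Equiv.Perm (Fin n))) (x : M)
    (a : Fin n → A) :
    chainAction A M n e (pureChain x a) = permOp A (Chain A M n) n e (pureChain x) a := by
  have h : chainAction A M n e (pureChain x a) = chainMk n x (algAction A n e (tpure a)) := by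
    simp [chainAction, pureChain, chainMk]
  rw [h, algAction_pure]
  exact map_permOp (chainMk n x).toLinearMap e tpure a

lemma chainAction_mul {n : ℕ} (e e' : MonoidAlgebra ℂ (Equiv.Perm (Fin n))) (c : Chain A M n) :
    chainAction A M n (e * e') c = chainAction A M n e (chainAction A M n e' c) := by
  have h : chainAction A M n (e * e') = chainAction A M n e ∘L chainAction A M n e' := by
    refine chain_ext fun x a => ?_
    rw [ContinuousLinearMap.comp_apply, chainAction_pureChain, chainAction_pureChain, permOp_mul]
    refine Eq.trans ?_ (map_permOp (chainAction A M n e).toLinearMap e' (pureChain x) a).symm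
    simp only [ContinuousLinearMap.coe_coe, chainAction_pureChain]
  rw [h, ContinuousLinearMap.comp_apply]

lemma chainAction_one_add {n : ℕ} (e : MonoidAlgebra ℂ (Equiv.Perm (Fin n))) (c : Chain A M n) :
    chainAction A M n (1 + e) c = c + chainAction A M n e c := by
  have h : chainAction A M n (1 + e) = .id ℂ _ + chainAction A M n e :=
    chain_ext fun x a => by simp [chainAction_pureChain, permOp_one]
  rw [h, add_apply, ContinuousLinearMap.id_apply]

/-- The Harrison chains are the kernel of the shuffle element. -/
theorem mem_harrisonChains_iff {n : ℕ} {c : Chain A M n} :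
    c ∈ harrisonChains A M n ↔ chainAction A M n (shuffleElement n) c = 0 := by
  have h0 : chainAction A M n 0 = 0 := chain_ext fun x a => by simp [chainAction_pureChain]
  constructor
  · rintro ⟨b, rfl⟩
    rw [ContinuousLinearMap.coe_coe, ← chainAction_mul, shuffleElement_mul_bgs, h0]
    rfl
  · intro hc
    -- The idempotent is `1 + Q * s_n` by commutation, so it fixes every chain killed by `s_n`; such
    -- a chain is its own preimage.
    obtain ⟨Q, hQ, hcomm⟩ := exists_bgs_eq_one_add n
    refine ⟨c, ?_⟩
    rw [ContinuousLinearMap.coe_coe, hQ, hcomm.eq, chainAction_one_add, chainAction_mul, hc,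
      map_zero, add_zero]

lemma cochainAction_apply {n : ℕ} (e : MonoidAlgebra ℂ (Equiv.Perm (Fin n))) (ψ : Cochain A M n)
    (a : Fin n → A) : cochainAction A M n e ψ a = permOp A M n e ψ a := by
  rw [cochainAction, precomp_apply, algAction_pure, map_permOp]
  simp only [PiTensorProduct.lift.tprod]
  rfl

/-- The order is reversed because precomposition is a right action. -/
lemma cochainAction_mul {n : ℕ} (e e' : MonoidAlgebra ℂ (Equiv.Perm (Fin n)))
    (ψ : Cochain A M n) :
    cochainAction A M n (e * e') ψ = cochainAction A M n e' (cochainAction A M n e ψ) := by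
  ext a
  rw [cochainAction_apply, cochainAction_apply, permOp_mul,
    funext fun a => cochainAction_apply e ψ a]

lemma mem_harrisonCochains_iff {n : ℕ} {ψ : Cochain A M n} :
    ψ ∈ harrisonCochains A M n ↔ cochainAction A M n (shuffleElement n) ψ = 0 := by
  constructor
  · rintro ⟨φ, rfl⟩
    rw [ContinuousLinearMap.coe_coe, ← cochainAction_mul, bgs_mul_shuffleElement]
    ext a
    simp [cochainAction_apply]
  · intro hψ
    obtain ⟨Q, hQ, -⟩ := exists_bgs_eq_one_add n
    refine ⟨ψ, ?_⟩
    have h : cochainAction A M n (shuffleElement n * Q) ψ = 0 := by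
      rw [cochainAction_mul, hψ, map_zero]
    ext a
    have h' := DFunLike.congr_fun h a
    rw [cochainAction_apply] at h'
    rw [ContinuousLinearMap.coe_coe, hQ, cochainAction_apply, map_add, LinearMap.add_apply,
      Pi.add_apply, h', permOp_one]
    simp

/-! ### Compatibility with the boundary and coboundary -/

variable [IsScalarTower ℂ A A] [SMulCommClass ℂ A A] [BanachBimodule A M]

/-- Symmetry lets the last letter act like the first one, giving the shape treated with words. -/
lemma boundary_pureChain (hM : IsSymmetricBimodule A M) (n : ℕ) (x : M) (a : Fin (n + 1) → A) :
    boundary A M n (pureChain x a)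
      = tupleDifferential (pureChain x) (fun c => pureChain (BanachBimodule.ract c x)) a := by
  have h : ∀ t : PreChain A M n, (t : Chain A M n) = Completion.toComplL (𝕜 := ℂ) t :=
    fun _ => rfl
  rw [pureChain, boundary_pure, hM, h]
  simp only [map_add, map_sum, map_smul]
  rfl

lemma boundary_boundary (hM : IsSymmetricBimodule A M) (n : ℕ) (c : Chain A M (n + 2)) :
    boundary A M n (boundary A M (n + 1) c) = 0 := by
  have h : boundary A M n ∘L boundary A M (n + 1) = 0 := by
    refine chain_ext fun x a => ?_
    rw [ContinuousLinearMap.comp_apply, boundary_pureChain hM]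
    refine (map_tupleDifferential (boundary A M n).toLinearMap _ _ a).trans ?_
    have hr : ∀ c d : A, BanachBimodule.ract d (BanachBimodule.ract c x)
        = BanachBimodule.ract (d * c) x := fun c d => by
      rw [mul_comm, BanachBimodule.ract_mul]
    simp only [ContinuousLinearMap.coe_coe, boundary_pureChain hM, hr]
    exact tupleDifferential_tupleDifferential (pureChain x)
      (fun c => pureChain (BanachBimodule.ract c x)) a
  exact congrArg (fun u : Chain A M (n + 2) →L[ℂ] Chain A M n => u c) h

/-- On `x ⊗ a` the boundary is `x a - a x`. -/
lemma boundary_zero (hM : IsSymmetricBimodule A M) : boundary A M 0 = 0 := by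
  refine chain_ext fun x a => ?_
  have h : Fin.tail a = Fin.init a := Subsingleton.elim _ _
  simp [boundary_pureChain hM, tupleDifferential, h]

lemma boundary_chainAction (hM : IsSymmetricBimodule A M) (n : ℕ) (c : Chain A M (n + 1)) :
    boundary A M n (chainAction A M (n + 1) (shuffleElement (n + 1)) c)
      = chainAction A M n (shuffleElement n) (boundary A M n c) := by
  have h : boundary A M n ∘L chainAction A M (n + 1) (shuffleElement (n + 1))
      = chainAction A M n (shuffleElement n) ∘L boundary A M n := by
    refine chain_ext fun x a => ?_
    rw [ContinuousLinearMap.comp_apply, ContinuousLinearMap.comp_apply, chainAction_pureChain,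
      boundary_pureChain hM]
    refine (map_permOp (boundary A M n).toLinearMap _ _ a).trans
      (Eq.trans ?_ (map_tupleDifferential (chainAction A M n _).toLinearMap _ _ a).symm)
    simp only [ContinuousLinearMap.coe_coe, boundary_pureChain hM, chainAction_pureChain]
    exact congrFun (permOp_shuffleElement_tupleDifferential _ _) a
  exact congrArg (fun u : Chain A M (n + 1) →L[ℂ] Chain A M n => u c) h

lemma boundary_mem_harrisonChains (hM : IsSymmetricBimodule A M) {n : ℕ} {c : Chain A M (n + 1)}
    (hc : c ∈ harrisonChains A M (n + 1)) : boundary A M n c ∈ harrisonChains A M n := by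
  rw [mem_harrisonChains_iff] at hc ⊢
  rw [← boundary_chainAction hM, hc, map_zero]

lemma boundary_mem_harrisonCycles (hM : IsSymmetricBimodule A M) {n : ℕ} {c : Chain A M (n + 1)}
    (hc : c ∈ harrisonChains A M (n + 1)) : boundary A M n c ∈ harrisonCycles A M n := by
  cases n with
  | zero => exact boundary_mem_harrisonChains hM hc
  | succ n => exact ⟨boundary_mem_harrisonChains hM hc, boundary_boundary hM n c⟩

/-- The Harrison chains form a subcomplex of the Hochschild chains. -/
theorem harrisonBoundaries_le_harrisonCycles (hM : IsSymmetricBimodule A M) (n : ℕ) :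
    harrisonBoundaries A M n ≤ harrisonCycles A M n := by
  rintro _ ⟨c, hc, rfl⟩
  exact boundary_mem_harrisonCycles hM hc

lemma coboundary_eq_tupleDifferential (hM : IsSymmetricBimodule A M) (n : ℕ) (ψ : Cochain A M n)
    (a : Fin (n + 1) → A) :
    coboundary A M n ψ a = tupleDifferential ψ (fun c b => BanachBimodule.lact c (ψ b)) a := by
  rw [coboundary_apply, ← hM]
  rfl

lemma coboundary_coboundary (hM : IsSymmetricBimodule A M) (n : ℕ) (ψ : Cochain A M n) :
    coboundary A M (n + 1) (coboundary A M n ψ) = 0 := by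
  ext a
  -- Acting by `c` on a coboundary gives the differential with coefficients twisted by `c`, the form
  -- in which the square was computed.
  have h : ∀ (c : A) (b : Fin (n + 1) → A),
      BanachBimodule.lact c (tupleDifferential ψ (fun d b => BanachBimodule.lact d (ψ b)) b)
        = tupleDifferential (fun b => BanachBimodule.lact c (ψ b))
          (fun d b => BanachBimodule.lact (d * c) (ψ b)) b := fun c b => by
    simp only [mul_comm _ c, BanachBimodule.lact_mul]
    exact map_tupleDifferential (BanachBimodule.lact c : M →L[ℂ] M).toLinearMap _ _ b
  rw [coboundary_eq_tupleDifferential hM]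
  simp only [funext fun a => coboundary_eq_tupleDifferential hM n ψ a, h]
  exact tupleDifferential_tupleDifferential ψ (fun c b => BanachBimodule.lact c (ψ b)) a

lemma coboundary_zero (hM : IsSymmetricBimodule A M) : coboundary A M 0 = 0 := by
  ext ψ a
  have h : Fin.tail a = Fin.init a := Subsingleton.elim _ _
  simp [coboundary_eq_tupleDifferential hM, tupleDifferential, h]

lemma coboundary_cochainAction (hM : IsSymmetricBimodule A M) (n : ℕ) (ψ : Cochain A M n) :
    coboundary A M n (cochainAction A M n (shuffleElement n) ψ)
      = cochainAction A M (n + 1) (shuffleElement (n + 1)) (coboundary A M n ψ) := by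
  ext a
  have h : ∀ (c : A) (b : Fin n → A),
      BanachBimodule.lact c (permOp A M n (shuffleElement n) ψ b)
        = permOp A M n (shuffleElement n) (fun b => BanachBimodule.lact c (ψ b)) b := fun c b =>
    map_permOp (BanachBimodule.lact c : M →L[ℂ] M).toLinearMap _ _ b
  rw [coboundary_eq_tupleDifferential hM, cochainAction_apply,
    funext fun a => coboundary_eq_tupleDifferential hM n ψ a,
    permOp_shuffleElement_tupleDifferential]
  simp only [funext fun a => cochainAction_apply (shuffleElement n) ψ a, h]

lemma coboundary_mem_harrisonCochains (hM : IsSymmetricBimodule A M) {n : ℕ} {ψ : Cochain A M n}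
    (hψ : ψ ∈ harrisonCochains A M n) :
    coboundary A M n ψ ∈ harrisonCochains A M (n + 1) := by
  rw [mem_harrisonCochains_iff] at hψ ⊢
  rw [← coboundary_cochainAction hM, hψ, map_zero]

lemma coboundary_mem_harrisonCocycles (hM : IsSymmetricBimodule A M) {n : ℕ} {ψ : Cochain A M n}
    (hψ : ψ ∈ harrisonCochains A M n) :
    coboundary A M n ψ ∈ harrisonCocycles A M (n + 1) :=
  ⟨coboundary_mem_harrisonCochains hM hψ, coboundary_coboundary hM n ψ⟩

/-- The Harrison cochains form a subcomplex of the Hochschild cochains. -/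
theorem harrisonCoboundaries_le_harrisonCocycles (hM : IsSymmetricBimodule A M) (n : ℕ) :
    harrisonCoboundaries A M n ≤ harrisonCocycles A M n := by
  cases n with
  | zero => exact bot_le
  | succ n =>
    rintro _ ⟨ψ, hψ, rfl⟩
    exact coboundary_mem_harrisonCocycles hM hψ

end Actions

/-! ## Splittings -/

/-- `r` and `s` split the sequence formed by `i` and `q`. -/
structure Splitting {L M N : Type*} [NormedAddCommGroup L] [NormedSpace ℂ L]
    [NormedAddCommGroup M] [NormedSpace ℂ M] [NormedAddCommGroup N] [NormedSpace ℂ N]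
    (i : L →L[ℂ] M) (q : M →L[ℂ] N) (r : M →L[ℂ] L) (s : N →L[ℂ] M) : Prop where
  retract : ∀ l, r (i l) = l
  sect : ∀ z, q (s z) = z
  decomp : ∀ m, i (r m) + s (q m) = m

namespace Splitting

section

variable {L M N : Type*} [NormedAddCommGroup L] [NormedSpace ℂ L]
  [NormedAddCommGroup M] [NormedSpace ℂ M] [NormedAddCommGroup N] [NormedSpace ℂ N]
  {i : L →L[ℂ] M} {q : M →L[ℂ] N} {r : M →L[ℂ] L} {s : N →L[ℂ] M}

lemma injective (h : Splitting i q r s) : Function.Injective i :=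
  Function.LeftInverse.injective h.retract

lemma comp_eq_zero (h : Splitting i q r s) (l : L) : q (i l) = 0 := by
  have h₁ := h.decomp (i l)
  rw [h.retract, add_eq_left] at h₁
  rw [← h.sect (q (i l)), h₁, map_zero]

lemma eq_of_map_eq_zero (h : Splitting i q r s) {m : M} (hm : q m = 0) : i (r m) = m := by
  simpa [hm] using h.decomp m

end

section Connecting

variable {L M N L' M' N' : Type*} [NormedAddCommGroup L] [NormedSpace ℂ L]
  [NormedAddCommGroup M] [NormedSpace ℂ M] [NormedAddCommGroup N] [NormedSpace ℂ N]
  [NormedAddCommGroup L'] [NormedSpace ℂ L'] [NormedAddCommGroup M'] [NormedSpace ℂ M']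
  [NormedAddCommGroup N'] [NormedSpace ℂ N']
  {i : L →L[ℂ] M} {q : M →L[ℂ] N} {r : M →L[ℂ] L} {s : N →L[ℂ] M}
  {i' : L' →L[ℂ] M'} {q' : M' →L[ℂ] N'} {r' : M' →L[ℂ] L'} {s' : N' →L[ℂ] M'}
  {dL : L →L[ℂ] L'} {dM : M →L[ℂ] M'} {dN : N →L[ℂ] N'}

/-- The connecting map does not depend on the lift, up to a boundary. -/
lemma eq_connecting_add (h : Splitting i q r s) (h' : Splitting i' q' r' s')
    (hi : ∀ l, i' (dL l) = dM (i l)) {m : M} {l : L'} (hl : i' l = dM m) :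
    l = r' (dM (s (q m))) + dL (r m) := by
  rw [← h'.retract l, hl, ← h'.retract (dL (r m)), hi, ← map_add, ← map_add, add_comm, h.decomp]

/-- The element `dM (s z)` is killed by `q'`, and on the kernel of `q'` the map `i' r'` is the
identity. -/
lemma map_connecting (h : Splitting i q r s) (h' : Splitting i' q' r' s')
    (hq : ∀ m, q' (dM m) = dN (q m)) {z : N} (hz : dN z = 0) :
    i' (r' (dM (s z))) = dM (s z) :=
  h'.eq_of_map_eq_zero (by rw [hq, h.sect, hz])

end Connecting

end Splitting

/-! ### Functoriality of chains and cochains in the coefficients -/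

section Functoriality

variable {A : Type*} [NonUnitalNormedCommRing A] [NormedSpace ℂ A]
  {L M N : Type*} [NormedAddCommGroup L] [NormedSpace ℂ L]
  [NormedAddCommGroup M] [NormedSpace ℂ M] [NormedAddCommGroup N] [NormedSpace ℂ N]
  {i : L →L[ℂ] M} {q : M →L[ℂ] N} {r : M →L[ℂ] L} {s : N →L[ℂ] M}

lemma chainMap_pureChain (f : M →L[ℂ] N) {n : ℕ} (x : M) (a : Fin n → A) :
    chainMap A f n (pureChain x a) = pureChain (f x) a := by
  simp [chainMap, pureChain]

/-- The linear map `x ↦ x ⊗ a_1 ⊗ ⋯ ⊗ a_n`. -/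
def pureChainL (M : Type*) [NormedAddCommGroup M] [NormedSpace ℂ M] {n : ℕ} (a : Fin n → A) :
    M →L[ℂ] Chain A M n :=
  Completion.toComplL ∘L (ProjTensor.mk M (TPow A n)).flip (tpure a)

/-- Tensoring with a fixed space is an additive functor on bounded linear maps, so it preserves the
splitting equations although `r` and `s` ignore the actions. -/
lemma Splitting.chainMap (h : Splitting i q r s) (n : ℕ) :
    Splitting (chainMap A i n) (chainMap A q n) (chainMap A r n) (chainMap A s n) where
  retract c := by
    have h' : HarrisonBanach.chainMap A r n ∘L HarrisonBanach.chainMap A i n = .id ℂ _ :=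
      chain_ext fun x a => by simp [chainMap_pureChain, h.retract]
    exact congrArg (fun u : Chain A L n →L[ℂ] Chain A L n => u c) h'
  sect c := by
    have h' : HarrisonBanach.chainMap A q n ∘L HarrisonBanach.chainMap A s n = .id ℂ _ :=
      chain_ext fun x a => by simp [chainMap_pureChain, h.sect]
    exact congrArg (fun u : Chain A N n →L[ℂ] Chain A N n => u c) h'
  decomp c := by
    have h' : HarrisonBanach.chainMap A i n ∘L HarrisonBanach.chainMap A r n
        + HarrisonBanach.chainMap A s n ∘L HarrisonBanach.chainMap A q n = .id ℂ _ :=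
      chain_ext fun x a => by
        simp only [add_apply, ContinuousLinearMap.comp_apply, chainMap_pureChain,
          ContinuousLinearMap.id_apply]
        rw [← congrArg (fun y => pureChain y a) (h.decomp x)]
        exact (map_add (pureChainL M a) _ _).symm
    exact congrArg (fun u : Chain A M n →L[ℂ] Chain A M n => u c) h'

lemma Splitting.cochainMap (h : Splitting i q r s) (n : ℕ) :
    Splitting (cochainMap A i n) (cochainMap A q n) (cochainMap A r n) (cochainMap A s n) where
  retract ψ := by ext a; simp [h.retract]
  sect ψ := by ext a; simp [h.sect]
  decomp ψ := by ext a; simp [h.decomp]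

end Functoriality

/-! ## The long exact sequences -/

section LongExact

variable {A : Type*} [NonUnitalNormedCommRing A] [NormedSpace ℂ A] [IsScalarTower ℂ A A]
  [SMulCommClass ℂ A A]
  {L : Type*} [NormedAddCommGroup L] [NormedSpace ℂ L] [BanachBimodule A L]
  {M : Type*} [NormedAddCommGroup M] [NormedSpace ℂ M] [BanachBimodule A M]
  {N : Type*} [NormedAddCommGroup N] [NormedSpace ℂ N] [BanachBimodule A N]
  {i : BimoduleHom A L M} {q : BimoduleHom A M N} {r : M →L[ℂ] L} {s : N →L[ℂ] M}

/-! ### The long exact sequence in homology -/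

section Homology

lemma homologyClass_eq_iff {n : ℕ} {z z' : harrisonCycles A M n} :
    homologyClass z = homologyClass z' ↔ (z : Chain A M n) - z' ∈ harrisonBoundaries A M n :=
  Submodule.Quotient.eq _

lemma homologyClass_eq_zero_iff {n : ℕ} {z : harrisonCycles A M n} :
    homologyClass z = 0 ↔ (z : Chain A M n) ∈ harrisonBoundaries A M n :=
  Submodule.Quotient.mk_eq_zero _

lemma exists_homologyClass {n : ℕ} (x : HarrisonHomology A M n) :
    ∃ z : harrisonCycles A M n, homologyClass z = x :=
  Submodule.Quotient.mk_surjective _ x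

variable (h : Splitting i.toContinuousLinearMap q.toContinuousLinearMap r s)
include h

/-- Although `r` does not commute with the boundary, `i r m = m` when `q m = 0`. Hence `i` maps the
boundary of `r m` to that of `m`, which is zero, and `i` is injective. -/
lemma chainMap_retract_mem_harrisonCycles {n : ℕ} {m : Chain A M n}
    (hm : m ∈ harrisonCycles A M n) (hq : chainMap A q.toContinuousLinearMap n m = 0) :
    chainMap A r n m ∈ harrisonCycles A L n := by
  cases n with
  | zero => exact chainMap_mem_harrisonChains _ hm
  | succ n =>
    refine ⟨chainMap_mem_harrisonChains _ hm.1, (h.chainMap n).injective ?_⟩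
    have hm' : boundary A M n m = 0 := hm.2
    rw [ContinuousLinearMap.coe_coe, chainMap_boundary, (h.chainMap (n + 1)).eq_of_map_eq_zero hq,
      hm', map_zero]

lemma connecting_mem_harrisonCycles (hM : IsSymmetricBimodule A M) {n : ℕ} {z : Chain A N (n + 1)}
    (hz : z ∈ harrisonCycles A N (n + 1)) :
    chainMap A r n (boundary A M n (chainMap A s (n + 1) z)) ∈ harrisonCycles A L n := by
  refine chainMap_retract_mem_harrisonCycles h
    (boundary_mem_harrisonCycles hM (chainMap_mem_harrisonChains s hz.1)) ?_
  rw [chainMap_boundary, (h.chainMap (n + 1)).sect]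
  exact hz.2

/-- The connecting map in Harrison homology. -/
def homologyConnecting (hM : IsSymmetricBimodule A M) (n : ℕ) :
    HarrisonHomology A N (n + 1) →L[ℂ] HarrisonHomology A L n :=
  Submodule.liftQL _ (Submodule.mkQL _ ∘L
    (chainMap A r n ∘L boundary A M n ∘L chainMap A s (n + 1)).restrict
      fun _ => connecting_mem_harrisonCycles h hM) <| by
    rintro ⟨z, hz⟩ ⟨w, hw, hwz⟩
    change boundary A N (n + 1) w = z at hwz
    subst hwz
    -- For `z = d w`, comparing the lift `d (s w)` of `z`, whose boundary is zero, with the lift `s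
    -- z` shows that `r d s z` is the boundary of `-r d s w`.
    refine (Submodule.Quotient.mk_eq_zero _).2
      ⟨-chainMap A r (n + 1) (boundary A M (n + 1) (chainMap A s (n + 2) w)), neg_mem
        (chainMap_mem_harrisonChains r (boundary_mem_harrisonChains hM
          (chainMap_mem_harrisonChains s hw))), ?_⟩
    have h₀ := (h.chainMap (n + 1)).eq_connecting_add (h.chainMap n) (chainMap_boundary i n)
      (m := boundary A M (n + 1) (chainMap A s (n + 2) w)) (l := 0)
      (by rw [map_zero, boundary_boundary hM])
    rw [chainMap_boundary, (h.chainMap (n + 2)).sect] at h₀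
    rw [ContinuousLinearMap.coe_coe, map_neg]
    exact neg_eq_of_add_eq_zero_left h₀.symm

lemma homologyConnecting_class (hM : IsSymmetricBimodule A M) {n : ℕ}
    (z : harrisonCycles A N (n + 1)) (m : Chain A M (n + 1))
    (hm : m ∈ harrisonChains A M (n + 1)) (l : harrisonCycles A L n)
    (hz : chainMap A q.toContinuousLinearMap (n + 1) m = z)
    (hl : chainMap A i.toContinuousLinearMap n l = boundary A M n m) :
    homologyConnecting h hM n (homologyClass z) = homologyClass l := by
  refine Eq.symm (homologyClass_eq_iff.2 ⟨chainMap A r (n + 1) m,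
    chainMap_mem_harrisonChains r hm, ?_⟩)
  have h₀ := (h.chainMap (n + 1)).eq_connecting_add (h.chainMap n) (chainMap_boundary i n) hl
  rw [hz] at h₀
  exact eq_sub_of_add_eq' h₀.symm

/-- The standard lift of a cycle represents the connecting map. -/
lemma exists_homologyConnecting_class (hM : IsSymmetricBimodule A M) {n : ℕ}
    (z : harrisonCycles A N (n + 1)) :
    ∃ l : harrisonCycles A L n,
      homologyConnecting h hM n (homologyClass z) = homologyClass l ∧
      chainMap A i.toContinuousLinearMap n l = boundary A M n (chainMap A s (n + 1) z) :=
  ⟨⟨_, connecting_mem_harrisonCycles h hM z.2⟩, rfl,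
    (h.chainMap (n + 1)).map_connecting (h.chainMap n) (chainMap_boundary q n) z.2.2⟩

lemma exact_homologyMap_homologyConnecting (hM : IsSymmetricBimodule A M) (n : ℕ) :
    Function.Exact (homologyMap q (n + 1)) (homologyConnecting h hM n) := by
  intro x
  obtain ⟨z, rfl⟩ := exists_homologyClass x
  constructor
  · intro hz
    obtain ⟨l, hl, hil⟩ := exists_homologyConnecting_class h hM z
    rw [hl, homologyClass_eq_zero_iff] at hz
    obtain ⟨b, hb, hbl⟩ := hz
    have hbl' : boundary A L n b = l := hbl
    -- Since `d (s z) = i (d b)`, subtracting `i b` turns the lift `s z` into a cycle without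
    -- changing its image under `q`.
    refine ⟨homologyClass ⟨chainMap A s (n + 1) z
      - chainMap A i.toContinuousLinearMap (n + 1) b,
        sub_mem (chainMap_mem_harrisonChains s z.2.1) (chainMap_mem_harrisonChains _ hb), ?_⟩, ?_⟩
    · change boundary A M n _ = 0
      rw [map_sub, ← hil, ← chainMap_boundary, hbl', sub_self]
    · rw [homologyMap_class]
      congr 1
      ext1
      change chainMap A q.toContinuousLinearMap (n + 1) (_ - _) = _
      rw [map_sub, (h.chainMap (n + 1)).sect, (h.chainMap (n + 1)).comp_eq_zero, sub_zero]
  · rintro ⟨y, hy⟩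
    obtain ⟨m, rfl⟩ := exists_homologyClass y
    have hm : boundary A M n m = 0 := m.2.2
    rw [← hy, homologyMap_class, homologyConnecting_class h hM _ (m : Chain A M (n + 1)) m.2.1 0 rfl
      (by rw [hm]; exact map_zero _)]
    rfl

lemma exact_homologyConnecting_homologyMap (hM : IsSymmetricBimodule A M) (n : ℕ) :
    Function.Exact (homologyConnecting h hM n) (homologyMap i n) := by
  intro x
  obtain ⟨l, rfl⟩ := exists_homologyClass x
  rw [homologyMap_class, homologyClass_eq_zero_iff]
  constructor
  · rintro ⟨m, hm, hml⟩
    have hml' : boundary A M n m = chainMap A i.toContinuousLinearMap n l := hml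
    refine ⟨homologyClass ⟨chainMap A q.toContinuousLinearMap (n + 1) m,
      chainMap_mem_harrisonChains _ hm, ?_⟩,
      homologyConnecting_class h hM _ m hm l rfl hml'.symm⟩
    change boundary A N n _ = 0
    rw [← chainMap_boundary, hml', (h.chainMap n).comp_eq_zero]
  · rintro ⟨y, hy⟩
    obtain ⟨z, rfl⟩ := exists_homologyClass y
    obtain ⟨l', hl', hil⟩ := exists_homologyConnecting_class h hM z
    rw [hl', homologyClass_eq_iff] at hy
    obtain ⟨b, hb, hbl⟩ := hy
    have hbl' : boundary A L n b = l' - l := hbl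
    -- The boundary of `s z` is `i l'`, and `i b` corrects it from `l'` to `l`.
    refine ⟨chainMap A s (n + 1) z - chainMap A i.toContinuousLinearMap (n + 1) b,
      sub_mem (chainMap_mem_harrisonChains s z.2.1) (chainMap_mem_harrisonChains _ hb), ?_⟩
    change boundary A M n _ = chainMap A i.toContinuousLinearMap n l
    rw [map_sub, ← hil, ← chainMap_boundary, hbl', map_sub, sub_sub_cancel]

lemma exact_homologyMap_homologyMap (hM : IsSymmetricBimodule A M) (n : ℕ) :
    Function.Exact (homologyMap i n) (homologyMap q n) := by
  intro x
  obtain ⟨m, rfl⟩ := exists_homologyClass x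
  rw [homologyMap_class, homologyClass_eq_zero_iff]
  constructor
  · rintro ⟨w, hw, hwm⟩
    have hwm' : boundary A N n w = chainMap A q.toContinuousLinearMap n m := hwm
    have hs := chainMap_mem_harrisonChains s hw
    have hq : chainMap A q.toContinuousLinearMap n
        (m - boundary A M n (chainMap A s (n + 1) w)) = 0 := by
      rw [map_sub, chainMap_boundary, (h.chainMap (n + 1)).sect, hwm', sub_self]
    -- Replacing `m` by the homologous cycle `m - d (s w)`, which `q` kills, makes it the image of
    -- its own retraction.
    refine ⟨homologyClass ⟨_, chainMap_retract_mem_harrisonCycles h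
      (sub_mem m.2 (boundary_mem_harrisonCycles hM hs)) hq⟩, ?_⟩
    rw [homologyMap_class, homologyClass_eq_iff]
    refine ⟨-chainMap A s (n + 1) w, neg_mem hs, ?_⟩
    change boundary A M n (-_) = chainMap A i.toContinuousLinearMap n (chainMap A r n _) - _
    rw [(h.chainMap n).eq_of_map_eq_zero hq, map_neg]
    abel
  · rintro ⟨y, hy⟩
    obtain ⟨l, rfl⟩ := exists_homologyClass y
    rw [homologyMap_class, homologyClass_eq_iff] at hy
    obtain ⟨b, hb, hbm⟩ := hy
    have hbm' : boundary A M n b = chainMap A i.toContinuousLinearMap n l - m := hbm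
    refine ⟨-chainMap A q.toContinuousLinearMap (n + 1) b,
      neg_mem (chainMap_mem_harrisonChains _ hb), ?_⟩
    change boundary A N n (-_) = chainMap A q.toContinuousLinearMap n m
    rw [map_neg, ← chainMap_boundary, hbm', map_sub, (h.chainMap n).comp_eq_zero, zero_sub, neg_neg]

/-- The boundary out of degree one is zero, so `s` sends cycles of degree one to cycles. -/
lemma surjective_homologyMap_one (hM : IsSymmetricBimodule A M) :
    Function.Surjective (homologyMap q 1) := by
  intro x
  obtain ⟨z, rfl⟩ := exists_homologyClass x
  refine ⟨homologyClass ⟨chainMap A s 1 z, chainMap_mem_harrisonChains s z.2.1, ?_⟩, ?_⟩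
  · rw [boundary_zero hM]
    rfl
  · rw [homologyMap_class]
    congr 1
    ext1
    exact (h.chainMap 1).sect (z : Chain A N 1)

end Homology

/-! ### The long exact sequence in cohomology -/

section Cohomology

lemma cohomologyClass_eq_iff {n : ℕ} {z z' : harrisonCocycles A M n} :
    cohomologyClass z = cohomologyClass z'
      ↔ (z : Cochain A M n) - z' ∈ harrisonCoboundaries A M n :=
  Submodule.Quotient.eq _

lemma cohomologyClass_eq_zero_iff {n : ℕ} {z : harrisonCocycles A M n} :
    cohomologyClass z = 0 ↔ (z : Cochain A M n) ∈ harrisonCoboundaries A M n :=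
  Submodule.Quotient.mk_eq_zero _

lemma exists_cohomologyClass {n : ℕ} (x : HarrisonCohomology A M n) :
    ∃ z : harrisonCocycles A M n, cohomologyClass z = x :=
  Submodule.Quotient.mk_surjective _ x

variable (h : Splitting i.toContinuousLinearMap q.toContinuousLinearMap r s)
include h

lemma cochainMap_retract_mem_harrisonCocycles {n : ℕ} {m : Cochain A M n}
    (hm : m ∈ harrisonCocycles A M n) (hq : cochainMap A q.toContinuousLinearMap n m = 0) :
    cochainMap A r n m ∈ harrisonCocycles A L n := by
  refine ⟨cochainMap_mem_harrisonCochains _ hm.1, (h.cochainMap (n + 1)).injective ?_⟩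
  have hm' : coboundary A M n m = 0 := hm.2
  rw [ContinuousLinearMap.coe_coe, cochainMap_coboundary, (h.cochainMap n).eq_of_map_eq_zero hq,
    hm', map_zero]

lemma connecting_mem_harrisonCocycles (hM : IsSymmetricBimodule A M) {n : ℕ} {z : Cochain A N n}
    (hz : z ∈ harrisonCocycles A N n) :
    cochainMap A r (n + 1) (coboundary A M n (cochainMap A s n z))
      ∈ harrisonCocycles A L (n + 1) := by
  refine cochainMap_retract_mem_harrisonCocycles h
    (coboundary_mem_harrisonCocycles hM (cochainMap_mem_harrisonCochains s hz.1)) ?_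
  rw [cochainMap_coboundary, (h.cochainMap n).sect]
  exact hz.2

/-- The connecting map in Harrison cohomology. -/
def cohomologyConnecting (hM : IsSymmetricBimodule A M) (n : ℕ) :
    HarrisonCohomology A N (n + 1) →L[ℂ] HarrisonCohomology A L (n + 2) :=
  Submodule.liftQL _ (Submodule.mkQL _ ∘L
    (cochainMap A r (n + 2) ∘L coboundary A M (n + 1) ∘L cochainMap A s (n + 1)).restrict
      fun _ => connecting_mem_harrisonCocycles h hM) <| by
    -- The source has degree `n + 1`, so its coboundaries are an image under `δ` and come with a
    -- preimage `w`.
    rintro ⟨z, hz⟩ ⟨w, hw, hwz⟩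
    change coboundary A N n w = z at hwz
    subst hwz
    refine (Submodule.Quotient.mk_eq_zero _).2
      ⟨-cochainMap A r (n + 1) (coboundary A M n (cochainMap A s n w)), neg_mem
        (cochainMap_mem_harrisonCochains r (coboundary_mem_harrisonCochains hM
          (cochainMap_mem_harrisonCochains s hw))), ?_⟩
    have h₀ := (h.cochainMap (n + 1)).eq_connecting_add (h.cochainMap (n + 2))
      (cochainMap_coboundary i (n + 1))
      (m := coboundary A M n (cochainMap A s n w)) (l := 0)
      (by rw [map_zero, coboundary_coboundary hM])
    rw [cochainMap_coboundary, (h.cochainMap n).sect] at h₀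
    rw [ContinuousLinearMap.coe_coe, map_neg]
    exact neg_eq_of_add_eq_zero_left h₀.symm

lemma cohomologyConnecting_class (hM : IsSymmetricBimodule A M) {n : ℕ}
    (z : harrisonCocycles A N (n + 1)) (m : Cochain A M (n + 1))
    (hm : m ∈ harrisonCochains A M (n + 1)) (l : harrisonCocycles A L (n + 2))
    (hz : cochainMap A q.toContinuousLinearMap (n + 1) m = z)
    (hl : cochainMap A i.toContinuousLinearMap (n + 2) l = coboundary A M (n + 1) m) :
    cohomologyConnecting h hM n (cohomologyClass z) = cohomologyClass l := by
  refine Eq.symm (cohomologyClass_eq_iff.2 ⟨cochainMap A r (n + 1) m,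
    cochainMap_mem_harrisonCochains r hm, ?_⟩)
  have h₀ := (h.cochainMap (n + 1)).eq_connecting_add (h.cochainMap (n + 2))
    (cochainMap_coboundary i (n + 1)) hl
  rw [hz] at h₀
  exact eq_sub_of_add_eq' h₀.symm

/-- The standard lift of a cocycle represents the connecting map. -/
lemma exists_cohomologyConnecting_class (hM : IsSymmetricBimodule A M) {n : ℕ}
    (z : harrisonCocycles A N (n + 1)) :
    ∃ l : harrisonCocycles A L (n + 2),
      cohomologyConnecting h hM n (cohomologyClass z) = cohomologyClass l ∧
      cochainMap A i.toContinuousLinearMap (n + 2) l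
        = coboundary A M (n + 1) (cochainMap A s (n + 1) z) :=
  ⟨⟨_, connecting_mem_harrisonCocycles h hM z.2⟩, rfl,
    (h.cochainMap (n + 1)).map_connecting (h.cochainMap (n + 2))
      (cochainMap_coboundary q (n + 1)) z.2.2⟩

lemma exact_cohomologyMap_cohomologyConnecting (hM : IsSymmetricBimodule A M) (n : ℕ) :
    Function.Exact (cohomologyMap q (n + 1)) (cohomologyConnecting h hM n) := by
  intro x
  obtain ⟨z, rfl⟩ := exists_cohomologyClass x
  constructor
  · intro hz
    obtain ⟨l, hl, hil⟩ := exists_cohomologyConnecting_class h hM z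
    rw [hl, cohomologyClass_eq_zero_iff] at hz
    obtain ⟨b, hb, hbl⟩ := hz
    have hbl' : coboundary A L (n + 1) b = l := hbl
    -- As in homology, subtracting `i b` makes the lift `s z` a cocycle.
    refine ⟨cohomologyClass ⟨cochainMap A s (n + 1) z
      - cochainMap A i.toContinuousLinearMap (n + 1) b,
        sub_mem (cochainMap_mem_harrisonCochains s z.2.1)
          (cochainMap_mem_harrisonCochains _ hb), ?_⟩, ?_⟩
    · change coboundary A M (n + 1) _ = 0
      rw [map_sub, ← hil, ← cochainMap_coboundary, hbl', sub_self]
    · rw [cohomologyMap_class]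
      congr 1
      ext1
      change cochainMap A q.toContinuousLinearMap (n + 1) (_ - _) = _
      rw [map_sub, (h.cochainMap (n + 1)).sect, (h.cochainMap (n + 1)).comp_eq_zero, sub_zero]
  · rintro ⟨y, hy⟩
    obtain ⟨m, rfl⟩ := exists_cohomologyClass y
    have hm : coboundary A M (n + 1) m = 0 := m.2.2
    rw [← hy, cohomologyMap_class, cohomologyConnecting_class h hM _ (m : Cochain A M (n + 1))
      m.2.1 0 rfl (by rw [hm]; exact map_zero _)]
    rfl

lemma exact_cohomologyConnecting_cohomologyMap (hM : IsSymmetricBimodule A M) (n : ℕ) :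
    Function.Exact (cohomologyConnecting h hM n) (cohomologyMap i (n + 2)) := by
  intro x
  obtain ⟨l, rfl⟩ := exists_cohomologyClass x
  rw [cohomologyMap_class, cohomologyClass_eq_zero_iff]
  constructor
  · rintro ⟨m, hm, hml⟩
    have hml' : coboundary A M (n + 1) m = cochainMap A i.toContinuousLinearMap (n + 2) l := hml
    refine ⟨cohomologyClass ⟨cochainMap A q.toContinuousLinearMap (n + 1) m,
      cochainMap_mem_harrisonCochains _ hm, ?_⟩,
      cohomologyConnecting_class h hM _ m hm l rfl hml'.symm⟩
    change coboundary A N (n + 1) _ = 0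
    rw [← cochainMap_coboundary, hml', (h.cochainMap (n + 2)).comp_eq_zero]
  · rintro ⟨y, hy⟩
    obtain ⟨z, rfl⟩ := exists_cohomologyClass y
    obtain ⟨l', hl', hil⟩ := exists_cohomologyConnecting_class h hM z
    rw [hl', cohomologyClass_eq_iff] at hy
    obtain ⟨b, hb, hbl⟩ := hy
    have hbl' : coboundary A L (n + 1) b = l' - l := hbl
    refine ⟨cochainMap A s (n + 1) z - cochainMap A i.toContinuousLinearMap (n + 1) b,
      sub_mem (cochainMap_mem_harrisonCochains s z.2.1) (cochainMap_mem_harrisonCochains _ hb), ?_⟩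
    change coboundary A M (n + 1) _ = cochainMap A i.toContinuousLinearMap (n + 2) l
    rw [map_sub, ← hil, ← cochainMap_coboundary, hbl', map_sub, sub_sub_cancel]

lemma exact_cohomologyMap_cohomologyMap (hM : IsSymmetricBimodule A M) (n : ℕ) :
    Function.Exact (cohomologyMap i (n + 1)) (cohomologyMap q (n + 1)) := by
  intro x
  obtain ⟨m, rfl⟩ := exists_cohomologyClass x
  rw [cohomologyMap_class, cohomologyClass_eq_zero_iff]
  constructor
  · rintro ⟨w, hw, hwm⟩
    have hwm' : coboundary A N n w = cochainMap A q.toContinuousLinearMap (n + 1) m := hwm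
    have hs := cochainMap_mem_harrisonCochains s hw
    have hq : cochainMap A q.toContinuousLinearMap (n + 1)
        (m - coboundary A M n (cochainMap A s n w)) = 0 := by
      rw [map_sub, cochainMap_coboundary, (h.cochainMap n).sect, hwm', sub_self]
    refine ⟨cohomologyClass ⟨_, cochainMap_retract_mem_harrisonCocycles h
      (sub_mem m.2 (coboundary_mem_harrisonCocycles hM hs)) hq⟩, ?_⟩
    rw [cohomologyMap_class, cohomologyClass_eq_iff]
    refine ⟨-cochainMap A s n w, neg_mem hs, ?_⟩
    change coboundary A M n (-_)
      = cochainMap A i.toContinuousLinearMap (n + 1) (cochainMap A r (n + 1) _) - _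
    rw [(h.cochainMap (n + 1)).eq_of_map_eq_zero hq, map_neg]
    abel
  · rintro ⟨y, hy⟩
    obtain ⟨l, rfl⟩ := exists_cohomologyClass y
    rw [cohomologyMap_class, cohomologyClass_eq_iff] at hy
    obtain ⟨b, hb, hbm⟩ := hy
    have hbm' : coboundary A M n b = cochainMap A i.toContinuousLinearMap (n + 1) l - m := hbm
    refine ⟨-cochainMap A q.toContinuousLinearMap n b,
      neg_mem (cochainMap_mem_harrisonCochains _ hb), ?_⟩
    change coboundary A N n (-_) = cochainMap A q.toContinuousLinearMap (n + 1) m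
    rw [map_neg, ← cochainMap_coboundary, hbm', map_sub, (h.cochainMap (n + 1)).comp_eq_zero,
      zero_sub, neg_neg]

/-- Coboundaries of degree one vanish, so injectivity on cohomology is injectivity of `i` on
cochains. -/
lemma injective_cohomologyMap_one (hM : IsSymmetricBimodule A M) :
    Function.Injective (cohomologyMap i 1) := by
  rw [injective_iff_map_eq_zero]
  intro x hx
  obtain ⟨l, rfl⟩ := exists_cohomologyClass x
  rw [cohomologyMap_class, cohomologyClass_eq_zero_iff] at hx
  obtain ⟨m, -, hm⟩ := hx
  rw [coboundary_zero hM] at hm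
  have hl : (l : Cochain A L 1) = 0 :=
    (h.cochainMap 1).injective (Eq.trans hm.symm (map_zero _).symm)
  rw [cohomologyClass_eq_zero_iff, hl]
  exact zero_mem _

end Cohomology

end LongExact

end HarrisonBanach

end

/-! ### Assembly of the two sequences -/

open HarrisonBanach in
theorem lemma4p1
    {A : Type*} [NonUnitalNormedCommRing A] [NormedSpace ℂ A] [IsScalarTower ℂ A A]
    [SMulCommClass ℂ A A] [CompleteSpace A]
    {L : Type*} [NormedAddCommGroup L] [NormedSpace ℂ L] [CompleteSpace L] [BanachBimodule A L]
    {M : Type*} [NormedAddCommGroup M] [NormedSpace ℂ M] [CompleteSpace M] [BanachBimodule A M]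
    {N : Type*} [NormedAddCommGroup N] [NormedSpace ℂ N] [CompleteSpace N] [BanachBimodule A N]
    (hL : IsSymmetricBimodule A L) (hM : IsSymmetricBimodule A M) (hN : IsSymmetricBimodule A N)
    (i : BimoduleHom A L M) (q : BimoduleHom A M N)
    (hiq : IsSplitShortExact i.toContinuousLinearMap q.toContinuousLinearMap) :
    -- the Harrison chains and cochains form subcomplexes of the Hochschild complexes
    ((∀ n, harrisonBoundaries A L n ≤ harrisonCycles A L n) ∧
      (∀ n, harrisonBoundaries A M n ≤ harrisonCycles A M n) ∧
      (∀ n, harrisonBoundaries A N n ≤ harrisonCycles A N n) ∧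
      (∀ n, harrisonCoboundaries A L n ≤ harrisonCocycles A L n) ∧
      (∀ n, harrisonCoboundaries A M n ≤ harrisonCocycles A M n) ∧
      (∀ n, harrisonCoboundaries A N n ≤ harrisonCocycles A N n)) ∧
    -- the long exact sequence in homology
    (∃ conn : ∀ n, HarrisonHomology A N (n + 2) →L[ℂ] HarrisonHomology A L (n + 1),
      (∀ (n : ℕ) (z : harrisonCycles A N (n + 2)) (m : harrisonChains A M (n + 2))
          (l : harrisonCycles A L (n + 1)),
        chainMap A q.toContinuousLinearMap (n + 2) m = z →
        chainMap A i.toContinuousLinearMap (n + 1) l = boundary A M (n + 1) m →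
        conn n (homologyClass z) = homologyClass l) ∧
      (∀ n, Function.Exact (homologyMap q (n + 2)) (conn n)) ∧
      (∀ n, Function.Exact (conn n) (homologyMap i (n + 1))) ∧
      (∀ n, Function.Exact (homologyMap i (n + 1)) (homologyMap q (n + 1))) ∧
      Function.Surjective (homologyMap q 1)) ∧
    -- the long exact sequence in cohomology
    (∃ conn : ∀ n, HarrisonCohomology A N (n + 1) →L[ℂ] HarrisonCohomology A L (n + 2),
      (∀ (n : ℕ) (z : harrisonCocycles A N (n + 1)) (m : harrisonCochains A M (n + 1))
          (l : harrisonCocycles A L (n + 2)),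
        cochainMap A q.toContinuousLinearMap (n + 1) m = z →
        cochainMap A i.toContinuousLinearMap (n + 2) l = coboundary A M (n + 1) m →
        conn n (cohomologyClass z) = cohomologyClass l) ∧
      Function.Injective (cohomologyMap i 1) ∧
      (∀ n, Function.Exact (cohomologyMap i (n + 1)) (cohomologyMap q (n + 1))) ∧
      (∀ n, Function.Exact (cohomologyMap q (n + 1)) (conn n)) ∧
      (∀ n, Function.Exact (conn n) (cohomologyMap i (n + 2)))) := by
  obtain ⟨r, s, hr, hs, hrs⟩ := hiq.split
  have h : Splitting i.toContinuousLinearMap q.toContinuousLinearMap r s :=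
    ⟨fun l => congrArg (fun u : L →L[ℂ] L => u l) hr,
      fun z => congrArg (fun u : N →L[ℂ] N => u z) hs,
      fun m => congrArg (fun u : M →L[ℂ] M => u m) hrs⟩
  exact ⟨⟨harrisonBoundaries_le_harrisonCycles hL, harrisonBoundaries_le_harrisonCycles hM,
      harrisonBoundaries_le_harrisonCycles hN, harrisonCoboundaries_le_harrisonCocycles hL,
      harrisonCoboundaries_le_harrisonCocycles hM, harrisonCoboundaries_le_harrisonCocycles hN⟩,
    -- The shift by one makes the sequence stop at degree one, leaving out the connecting map from
    -- degree one to degree zero.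
    ⟨fun n => homologyConnecting h hM (n + 1),
      fun n z m l => homologyConnecting_class h hM z m m.2 l,
      fun n => exact_homologyMap_homologyConnecting h hM (n + 1),
      fun n => exact_homologyConnecting_homologyMap h hM (n + 1),
      fun n => exact_homologyMap_homologyMap h hM (n + 1),
      surjective_homologyMap_one h hM⟩,
    ⟨cohomologyConnecting h hM,
      fun n z m l => cohomologyConnecting_class h hM z m m.2 l,
      injective_cohomologyMap_one h hM,
      exact_cohomologyMap_cohomologyMap h hM,
      exact_cohomologyMap_cohomologyConnecting h hM,
      exact_cohomologyConnecting_cohomologyMap h hM⟩⟩
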